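/- For a symmetric positive semidefinite matrix $S$ write $\|x\|_S=\sqrt{x^\top S x}$. For symmetric positive definite $A,M\in\mathbb R^{n\times n}$ let $\kappa_M=\sigma_1/\sigma_n$ be the ratio of the largest to the smallest singular value of $M^{-1/2}AM^{-1/2}$. Given $b\in\mathbb R^n$, a function $\mathsf{SolveM}:\mathbb R^n\to\mathbb R^n$ and a number of iterations $t$, *preconditioned Lanczos* is the following procedure in exact real arithmetic. Set $\overline w_0=\mathsf{SolveM}(b)$, $z'=\sqrt{\langle b,\overline w_0\rangle}$, $\underline q_0=0$, $\underline q_1=b/z'$, $\overline q_1=\overline w_0/z'$, $\beta'_1=0$. For $i=1,\dots,t$ compute $$\underline u_i=A\overline q_i-\beta'_i\underline q_{i-1},\quad \alpha'_i=\langle\underline u_i,\overline q_i\rangle,\quad \underline w_i=\underline u_i-\alpha'_i\underline q_i,\quad \overline w_i=\mathsf{SolveM}(\underline w_i),\quad \beta'_{i+1}=\langle\underline w_i,\overline w_i\rangle^{1/2},$$ leave the loop if $\beta'_{i+1}=0$, and otherwise set $\underline q_{i+1}=\underline w_i/\beta'_{i+1}$, $\overline q_{i+1}=\overline w_i/\beta'_{i+1}$.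 If $k\le t$ iterations were executed, let $T'$ be the symmetric tridiagonal $k\times k$ matrix with diagonal $\alpha'_1,\dots,\alpha'_k$ and off-diagonal entries $\beta'_2,\dots,\beta'_k$, let $\overline Q=[\overline q_1,\dots,\overline q_k]$, and return $x_t=z'\,\overline Q\,T'^{-1}e_1$, where $e_1\in\mathbb R^k$ is the first standard basis vector. (For $b=0$, where $z'=0$, the output is understood to be $0$.) **Theorem.** There are absolute constants $c>0$ and $C>0$ such that the following holds for all $n$, all symmetric positive definite $A,M\in\mathbb R^{n\times n}$, all $b\in\mathbb R^n$, all $\epsilon\in(0,1)$, all real $\epsilon_0\le\left(\frac{\epsilon}{\kappa_M n}\right)^c$ and all functions $\mathsf{SolveM}:\mathbb R^n\to\mathbb R^n$ with $$\|\mathsf{SolveM}(r)-M^{-1}r\|_M\le\epsilon_0\,\|M^{-1}r\|_M\qquad\text{for every } r\in\mathbb R^n .$$ If preconditioned Lanczos is run with $t=\lceil C\sqrt{\kappa_M}\,\log(\kappa_M/\epsilon)\rceil$ iterations, then (for $b\ne0$) it is well defined, that is, $z'>0$ and $T'$ is invertible, and its output satisfies $$\|x_t-A^{-1}b\|_A\le\epsilon\,\|A^{-1}b\|_A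 .$$ -/

import Mathlib

open scoped Matrix MatrixOrder

noncomputable section

namespace PrecondLanczos

/-- The norm `‖x‖_S = √(xᵀ S x)` given by a positive semidefinite matrix `S`. -/
def matNorm {n : ℕ} (S : Matrix (Fin n) (Fin n) ℝ) (x : Fin n → ℝ) : ℝ :=
  √(x ⬝ᵥ (S *ᵥ x))

/-- The condition number `σ₁ / σₙ` of an `n × n` matrix, the quotient of its largest and its
smallest singular value (Mathlib counts singular values from `0`). -/
def condNumber {n : ℕ} (B : Matrix (Fin n) (Fin n) ℝ) : ℝ :=
  (Matrix.toEuclideanLin B).singularValues 0 / (Matrix.toEuclideanLin B).singularValues (n - 1)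

/-- The condition number `κ_M` of the preconditioned matrix `M^{-1/2} A M^{-1/2}`. -/
def precondNumber {n : ℕ} (A M : Matrix (Fin n) (Fin n) ℝ) : ℝ :=
  condNumber ((CFC.sqrt M)⁻¹ * A * (CFC.sqrt M)⁻¹)

/-- The variables of the iteration at the beginning of the loop body with loop index `i`. -/
structure State (n : ℕ) where
  /-- the scalar `βᵢ'` -/
  beta : ℝ
  /-- the vector `q̲ᵢ₋₁` -/
  qPrev : Fin n → ℝ
  /-- the vector `q̲ᵢ` -/
  qLow : Fin n → ℝ
  /-- the vector `q̅ᵢ` -/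
  qUp : Fin n → ℝ

section Algorithm

variable {n : ℕ} (A : Matrix (Fin n) (Fin n) ℝ) (b : Fin n → ℝ)
  (SolveM : (Fin n → ℝ) → (Fin n → ℝ))

/-- `z' = √⟨b, w̅₀⟩`, where `w̅₀ = SolveM(b)`. -/
def zInit : ℝ := √(b ⬝ᵥ SolveM b)

/-- Initialization: `β₁' = 0`, `q̲₀ = 0`, `q̲₁ = b / z'`, `q̅₁ = w̅₀ / z'`. -/
def init : State n where
  beta := 0
  qPrev := 0
  qLow := (zInit b SolveM)⁻¹ • b
  qUp := (zInit b SolveM)⁻¹ • SolveM b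

/-- `u̲ᵢ = A q̅ᵢ - βᵢ' q̲ᵢ₋₁`. -/
def uLow (s : State n) : Fin n → ℝ := A *ᵥ s.qUp - s.beta • s.qPrev

/-- `αᵢ' = ⟨u̲ᵢ, q̅ᵢ⟩`. -/
def alpha (s : State n) : ℝ := uLow A s ⬝ᵥ s.qUp

/-- `w̲ᵢ = u̲ᵢ - αᵢ' q̲ᵢ`. -/
def wLow (s : State n) : Fin n → ℝ := uLow A s - alpha A s • s.qLow

/-- `βᵢ₊₁' = ⟨w̲ᵢ, w̅ᵢ⟩^{1/2}`, where `w̅ᵢ = SolveM(w̲ᵢ)`. -/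
def betaNext (s : State n) : ℝ := √(wLow A s ⬝ᵥ SolveM (wLow A s))

/-- One execution of the loop body (the test for `βᵢ₊₁' = 0` is in `numIter`):
`q̲ᵢ₊₁ = w̲ᵢ / βᵢ₊₁'` and `q̅ᵢ₊₁ = w̅ᵢ / βᵢ₊₁'`. -/
def step (s : State n) : State n where
  beta := betaNext A SolveM s
  qPrev := s.qLow
  qLow := (betaNext A SolveM s)⁻¹ • wLow A s
  qUp := (betaNext A SolveM s)⁻¹ • SolveM (wLow A s)

/-- The state at the beginning of iteration `i + 1`. It is only ever used for iterations that the
algorithm really starts, see `numIter`. -/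
def stateAt : ℕ → State n
  | 0 => init b SolveM
  | i + 1 => step A SolveM (stateAt i)

/-- The number `k ≤ t` of iterations that are executed when at most `t` iterations are allowed:
the loop is left after the first iteration `k ≥ 1` with `β_{k+1}' = 0`, and otherwise
after iteration `t`. -/
def numIter (t : ℕ) : ℕ :=
  sInf {k : ℕ | k = t ∨ (1 ≤ k ∧ k ≤ t ∧ (stateAt A b SolveM k).beta = 0)}

/-- The `k × k` symmetric tridiagonal matrix with diagonal `α₁', …, α_k'` and with
`β₂', …, β_k'` above and below the diagonal. -/
def tridiag (k : ℕ) : Matrix (Fin k) (Fin k) ℝ :=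
  Matrix.of fun i j =>
    if i = j then alpha A (stateAt A b SolveM i)
    else if (j : ℕ) = i + 1 then (stateAt A b SolveM j).beta
    else if (i : ℕ) = j + 1 then (stateAt A b SolveM i).beta
    else 0

/-- The `n × k` matrix with columns `q̅₁, …, q̅_k`. -/
def basisMatrix (k : ℕ) : Matrix (Fin n) (Fin k) ℝ :=
  Matrix.of fun r j => (stateAt A b SolveM j).qUp r

/-- The first standard basis vector of `ℝᵏ`. -/
def firstVec (k : ℕ) : Fin k → ℝ := fun j => if (j : ℕ) = 0 then 1 else 0

/-- The matrix `T'` at the end of a run with at most `t` iterations. -/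
def finalT (t : ℕ) : Matrix (Fin (numIter A b SolveM t)) (Fin (numIter A b SolveM t)) ℝ :=
  tridiag A b SolveM (numIter A b SolveM t)

/-- The output `z' Q̅ T'⁻¹ e₁` of a run with at most `t` iterations. -/
def output (t : ℕ) : Fin n → ℝ :=
  zInit b SolveM •
    (basisMatrix A b SolveM (numIter A b SolveM t) *ᵥ
      ((finalT A b SolveM t)⁻¹ *ᵥ firstVec (numIter A b SolveM t)))

end Algorithm

end PrecondLanczos

end

/-! Put `B = M^{-1/2} A M^{-1/2}`, with spectrum in `[m, Λ]` and `κ = Λ / m`, and scale the vectors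
to `q = M^{-1/2} q̲` and `p = M^{1/2} q̅`. In these coordinates the three-term recurrence for `B p`
holds exactly, `p` is `ε₀`-close to `q`, and `⟨q i, p i⟩ = 1`, `β (i + 1) * ⟨q (i + 1), p i⟩ = 0`
(`PrecondLanczos.perturbedLanczos`). Orthogonality is controlled only between neighbours, so no
comparison with exact Krylov spaces is made. Everything is read off `T'` and its recurrence.

The spectrum of `T'` stays almost inside `[m, Λ]`. For a shifted and scaled operator `G ≥ 1`, let `d
j` be the `L D Lᵀ` pivots of the equally transformed tridiagonal matrix and `v j` the columns of `Q
L⁻ᵀ`. With exact orthonormality `⟨G v, v⟩ = d`. Using only local near-orthogonality, the discrepancy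
relative to `‖v‖²` grows only polynomially in `j`, so all pivots are positive
(`NearRecurrence.pivot_pos`). Applied at both ends of the spectrum, this gives `T' ≥ 9/10 m` and
`|β| ≤ (Λ - 4/5 m) / 2` (`PerturbedLanczos.le_tridiagForm`, `PerturbedLanczos.abs_beta_le`).

For `x = T'⁻¹ e₁`, the scaled residual of `∑ x i • p i` has the single term `x j * β (j + 1)` times
`q (j + 1)`, where `j` is the last index. It vanishes on breakdown. Otherwise `x j` decays
geometrically: conjugating `T'` by `ρ^i` changes its quadratic form only at order `β (ρ - 1)²`,
since first-order terms cancel by symmetry. Hence `ρ - 1` may be of size `√(m / Λ)`, which is where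
`√κ` comes from (`decay_of_tridiag_solution`). A small residual gives a small energy error at the
cost of a factor `κ`, absorbed by the logarithm. -/

/-! ### Positivity of the pivots of an approximate three-term recurrence -/

section Pivots

variable {E : Type*} [NormedAddCommGroup E] [InnerProductSpace ℝ E]

/-- The pivots of the `L D Lᵀ` factorization of the symmetric tridiagonal matrix with diagonal `a`
and off-diagonal entries `b 1, b 2, …`. -/
noncomputable def pivot (a b : ℕ → ℝ) : ℕ → ℝ
  | 0 => a 0
  | j + 1 => a (j + 1) - b (j + 1) ^ 2 / pivot a b j

/-- The columns of `V L⁻ᵀ` for the matrix `V` with columns `v 0, v 1, …` and the unit bidiagonal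
factor `L` of the tridiagonal matrix given by `a` and `b`. -/
noncomputable def sweep (a b : ℕ → ℝ) (v : ℕ → E) : ℕ → E
  | 0 => v 0
  | j + 1 => v (j + 1) - (b (j + 1) / pivot a b j) • sweep a b v j

/-- A three-term recurrence `G qᵢ = bᵢ₊₁ qᵢ₊₁ + aᵢ qᵢ + bᵢ qᵢ₋₁ + rᵢ` of length `k`, with vectors that
are nearly normalized and locally nearly orthogonal. -/
structure NearRecurrence (G : E →ₗ[ℝ] E) (a b : ℕ → ℝ) (q r : ℕ → E) (k : ℕ) (δ : ℝ) : Prop where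
  zero : b 0 = 0
  recur : ∀ i < k, G (q i) = b (i + 1) • q (i + 1) + a i • q i + b i • q (i - 1) + r i
  err : ∀ i < k, ‖r i‖ ≤ δ
  unit : ∀ i < k, |‖q i‖ ^ 2 - 1| ≤ δ
  orth : ∀ i < k, |b (i + 1) * inner ℝ (q i) (q (i + 1))| ≤ δ

/-- `⟨G pⱼ, pⱼ⟩ - dⱼ ‖qⱼ‖²` up to the contribution of the recurrence error, for the swept
vectors `pⱼ`. -/
noncomputable def defect (a b : ℕ → ℝ) (q : ℕ → E) (j : ℕ) : ℝ :=
  b (j + 1) * inner ℝ (sweep a b q j) (q (j + 1)) -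
    pivot a b j * (‖q j‖ ^ 2 - inner ℝ (sweep a b q j) (q j))

/-- The quantities that are propagated along the sweep. -/
structure SweepBounds (G : E →ₗ[ℝ] E) (a b : ℕ → ℝ) (q r : ℕ → E) (δ ν : ℝ) (j : ℕ) : Prop where
  half : 1 / 2 ≤ ‖sweep a b q j‖ ^ 2
  recur : G (sweep a b q j) = pivot a b j • q j + b (j + 1) • q (j + 1) + sweep a b r j
  err : ‖sweep a b r j‖ ≤ 2 * δ * (j + 1) * ‖sweep a b q j‖
  defect_le : |defect a b q j| ≤ ν * (j + 1) * ‖sweep a b q j‖ ^ 2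
  loss : |‖q j‖ ^ 2 - inner ℝ (sweep a b q j) (q j)| ≤ 2 * ν * j ^ 2

/-- Pairing `G p` with `p` gives `d ‖q‖²` plus the defect plus the error term. The last two are at
most `1/8 ‖p‖²` each, so coercivity of `G` forces `d` to be positive and comparable to `‖p‖²`. -/
theorem SweepBounds.le_pivot {G : E →ₗ[ℝ] E} {a b : ℕ → ℝ} {q r : ℕ → E} {δ ν : ℝ} {j : ℕ}
    (h : SweepBounds G a b q r δ ν j) (hG : ∀ x, ‖x‖ ^ 2 ≤ inner ℝ (G x) x)
    (hq : |‖q j‖ ^ 2 - 1| ≤ 1 / 4) (hν : ν * (j + 1) ≤ 1 / 8) (hδ : 2 * δ * (j + 1) ≤ 1 / 8) :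
    ‖sweep a b q j‖ ^ 2 ≤ 2 * pivot a b j := by
  have h1 := hG (sweep a b q j)
  have h2 := h.half
  have h3 := h.err
  have h4 := h.defect_le
  rw [h.recur, inner_add_left, inner_add_left, real_inner_smul_left, real_inner_smul_left] at h1
  unfold defect at h4
  set p := sweep a b q j
  set g := sweep a b r j
  set d := pivot a b j
  rw [real_inner_comm p (q j), real_inner_comm p (q (j + 1))] at h1
  have h5 : inner ℝ g p ≤ 1 / 8 * ‖p‖ ^ 2 := by
    calc inner ℝ g p ≤ ‖g‖ * ‖p‖ := real_inner_le_norm _ _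
      _ ≤ (1 / 8 * ‖p‖) * ‖p‖ := by
        gcongr
        exact h3.trans (by gcongr)
      _ = _ := by ring
  have h6 : ν * (j + 1) * ‖p‖ ^ 2 ≤ 1 / 8 * ‖p‖ ^ 2 := by gcongr
  have h7 := (abs_le.mp h4).2
  have h8 := abs_le.mp hq
  have h9 : 3 / 4 * ‖p‖ ^ 2 ≤ d * ‖q j‖ ^ 2 := by linarith
  have hd : 0 < d := by
    by_contra hd
    nlinarith [sq_nonneg ‖q j‖, mul_nonneg (not_lt.mp hd |> neg_nonneg.mpr) (sq_nonneg ‖q j‖)]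
  nlinarith

/-- Up to errors of size `δ`, the diagonal entry is the Rayleigh quotient of `G` at `q i`. -/
theorem NearRecurrence.diag_le {G : E →ₗ[ℝ] E} {a b : ℕ → ℝ} {q r : ℕ → E} {δ K : ℝ} {k : ℕ}
    (h : NearRecurrence G a b q r k δ) (hδ : δ ≤ 1 / 100) (hK : 1 ≤ K)
    (hG : ∀ x, inner ℝ (G x) x ≤ K * ‖x‖ ^ 2) {i : ℕ} (hi : i < k) : a i ≤ 2 * K := by
  have h1 := hG (q i)
  have hu := abs_le.mp (h.unit i hi)
  have hδ0 : 0 ≤ δ := (norm_nonneg _).trans (h.err i hi)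
  rw [h.recur i hi, inner_add_left, inner_add_left, inner_add_left, real_inner_smul_left,
    real_inner_smul_left, real_inner_smul_left, real_inner_self_eq_norm_sq,
    real_inner_comm] at h1
  have h2 : -δ ≤ b i * inner ℝ (q (i - 1)) (q i) := by
    rcases i with _ | i
    · simp [h.zero, hδ0]
    · exact (abs_le.mp (h.orth i (by omega))).1
  have h3 := (abs_le.mp (h.orth i hi)).1
  have h4 : -(2 * δ) ≤ inner ℝ (r i) (q i) := by
    have h5 : |inner ℝ (r i) (q i)| ≤ ‖r i‖ * ‖q i‖ := abs_real_inner_le_norm _ _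
    have h6 : ‖q i‖ ≤ 2 := by nlinarith [norm_nonneg (q i)]
    have h7 : ‖r i‖ * ‖q i‖ ≤ δ * 2 := by
      have := h.err i hi
      gcongr
    linarith [(abs_le.mp h5).1]
  by_contra hc
  push Not at hc
  nlinarith

theorem two_thirds_le_of_half_le_sq {x : ℝ} (hx : 0 ≤ x) (h : 1 / 2 ≤ x ^ 2) : 2 / 3 ≤ x := by
  nlinarith

-- The induction step of the sweep. The defect is measured against `‖p‖²` because the recursion
-- multiplies it by `l²`, with `l` the entry of `L`, while `‖p‖²` grows by at least the same factor.
-- Relative errors therefore add up instead of multiplying.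
set_option maxHeartbeats 1000000 in
theorem NearRecurrence.sweepBounds_succ {G : E →ₗ[ℝ] E} (hsym : G.IsSymmetric) {a b : ℕ → ℝ}
    {q r : ℕ → E} {δ ν K : ℝ} {k j : ℕ} (h : NearRecurrence G a b q r k δ) (hj : j + 1 < k)
    (hδ : δ ≤ 1 / 100) (hK : 1 ≤ K) (hν : ν = 20 * K * k * δ) (hsmall : 2 * ν * (j + 1) ^ 2 ≤ 1 / 8)
    (hdK : pivot a b j ≤ 2 * K)
    (hd : ‖sweep a b q j‖ ^ 2 ≤ 2 * pivot a b j) (hs : SweepBounds G a b q r δ ν j) :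
    SweepBounds G a b q r δ ν (j + 1) := by
  obtain ⟨h1, h2, h3, h4, h5⟩ := hs
  have hδ0 : 0 ≤ δ := (norm_nonneg _).trans (h.err j (by omega))
  have hν0 : 0 ≤ ν := by rw [hν]; positivity
  have hu := abs_le.mp (h.unit j (by omega))
  have hu' := abs_le.mp (h.unit (j + 1) hj)
  have hθ := abs_le.mp (h.orth j (by omega))
  have hθ' := abs_le.mp (h.orth (j + 1) hj)
  have hr := h.err (j + 1) hj
  have hrec := h.recur (j + 1) hj
  have hb : pivot a b (j + 1) = a (j + 1) - b (j + 1) ^ 2 / pivot a b j := rfl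
  have hp' : sweep a b q (j + 1) = q (j + 1) - (b (j + 1) / pivot a b j) • sweep a b q j := rfl
  have hg' : sweep a b r (j + 1) = r (j + 1) - (b (j + 1) / pivot a b j) • sweep a b r j := rfl
  unfold defect at h4
  rw [Nat.add_sub_cancel] at hrec
  have hdpos : 0 < pivot a b j := by linarith
  set p := sweep a b q j
  set g := sweep a b r j
  set d := pivot a b j
  set l := b (j + 1) / d with hl
  have hld : l * d = b (j + 1) := by rw [hl]; field_simp
  have hbl : b (j + 1) ^ 2 / d = l * b (j + 1) := by rw [hl]; ring
  rw [hbl] at hb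
  clear_value l
  set e := l * inner ℝ p (q (j + 1)) with he
  -- the loss of orthogonality at the next step
  have hloss : ‖q (j + 1)‖ ^ 2 - inner ℝ (sweep a b q (j + 1)) (q (j + 1)) = e := by
    rw [hp', inner_sub_left, real_inner_smul_left, real_inner_self_eq_norm_sq]; ring
  have hdef : b (j + 1) * inner ℝ p (q (j + 1)) = d * e := by rw [he, ← hld]; ring
  have he_bound : |e| ≤ 2 * ν * (j + 1) ^ 2 := by
    -- The current defect is `d` times the increment of the orthogonality loss. Dividing by `d ≥
    -- ‖p‖² / 2` bounds the increment, and the increments sum to the quadratic bound.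
    rw [hdef, ← mul_sub, abs_mul, abs_of_pos hdpos] at h4
    have h6 : |e - (‖q j‖ ^ 2 - inner ℝ p (q j))| ≤ 2 * ν * (j + 1) := by
      have : d * |e - (‖q j‖ ^ 2 - inner ℝ p (q j))| ≤ d * (2 * ν * (j + 1)) := by
        calc _ ≤ ν * (j + 1) * ‖p‖ ^ 2 := h4
          _ ≤ ν * (j + 1) * (2 * d) := by gcongr
          _ = _ := by ring
      exact le_of_mul_le_mul_left this hdpos
    have h7 := abs_add_le (e - (‖q j‖ ^ 2 - inner ℝ p (q j))) (‖q j‖ ^ 2 - inner ℝ p (q j))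
    rw [sub_add_cancel] at h7
    have h8 : 0 ≤ ν * (j : ℝ) := by positivity
    linarith
  have he' := abs_le.mp (he_bound.trans hsmall)
  have hN : ‖sweep a b q (j + 1)‖ ^ 2 = ‖q (j + 1)‖ ^ 2 - 2 * e + l ^ 2 * ‖p‖ ^ 2 := by
    rw [hp', norm_sub_sq_real, inner_smul_right, norm_smul, mul_pow, Real.norm_eq_abs, sq_abs,
      real_inner_comm]
  set N := ‖p‖ ^ 2 with hNdef
  set p' := sweep a b q (j + 1)
  -- This inequality absorbs every power of `l` below: both `l ^ 2 * N` and the square of `|l| *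
  -- ‖p‖` are at most `‖p'‖ ^ 2`.
  have hN' : 1 / 2 + l ^ 2 * N ≤ ‖p'‖ ^ 2 := by rw [hN]; linarith
  have hlN0 : 0 ≤ l ^ 2 * N := by positivity
  have hhalf : 1 / 2 ≤ ‖p'‖ ^ 2 := by linarith
  have hp'half : 2 / 3 ≤ ‖p'‖ := two_thirds_le_of_half_le_sq (norm_nonneg _) hhalf
  have hlp : |l| * ‖p‖ ≤ ‖p'‖ := by
    refine (pow_le_pow_iff_left₀ (by positivity) (norm_nonneg _) two_ne_zero).mp ?_
    rw [mul_pow, sq_abs]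
    linarith
  have hpp : ‖p'‖ ≤ 3 / 2 * ‖p'‖ ^ 2 := by
    have := mul_le_mul_of_nonneg_right hp'half (norm_nonneg p')
    linarith
  have hq' : ‖q (j + 1)‖ ≤ 11 / 10 := by
    refine (pow_le_pow_iff_left₀ (norm_nonneg _) (by norm_num) two_ne_zero).mp ?_
    linarith
  have hG' : G p' = pivot a b (j + 1) • q (j + 1) + b (j + 1 + 1) • q (j + 1 + 1) +
      sweep a b r (j + 1) := by
    rw [hp', hg', map_sub, map_smul, h2, hrec, hb, ← hld]
    module
  refine ⟨hhalf, hG', ?_, ?_, ?_⟩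
  · rw [hg']
    calc ‖r (j + 1) - l • g‖ ≤ ‖r (j + 1)‖ + ‖l • g‖ := norm_sub_le _ _
      _ ≤ δ + |l| * (2 * δ * (j + 1) * ‖p‖) := by
        rw [norm_smul, Real.norm_eq_abs]; gcongr
      _ = δ + 2 * δ * (j + 1) * (|l| * ‖p‖) := by ring
      _ ≤ δ * (2 * ‖p'‖) + 2 * δ * (j + 1) * ‖p'‖ := by
        refine add_le_add (le_mul_of_one_le_right hδ0 (by linarith)) ?_
        gcongr
      _ = _ := by push_cast; ring
  · set θ := b (j + 1) * inner ℝ (q j) (q (j + 1)) with hθdef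
    set θ' := b (j + 1 + 1) * inner ℝ (q (j + 1)) (q (j + 1 + 1)) with hθ'def
    have hsymm : inner ℝ (G p) (q (j + 1)) = inner ℝ p (G (q (j + 1))) := hsym _ _
    rw [h2, hrec, inner_add_left, inner_add_left, inner_add_right, inner_add_right,
      inner_add_right, real_inner_smul_left, real_inner_smul_left, inner_smul_right,
      inner_smul_right, inner_smul_right, real_inner_self_eq_norm_sq] at hsymm
    -- Symmetry of `G`, tested on `p` and `q (j + 1)` and multiplied by `l`, expresses the new
    -- defect as `l ^ 2` times the old one plus local errors.
    have hnext : defect a b q (j + 1) = l ^ 2 * (b (j + 1) * inner ℝ p (q (j + 1)) -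
        d * (‖q j‖ ^ 2 - inner ℝ p (q j))) + (θ' - θ - l ^ 2 * d * (‖q (j + 1)‖ ^ 2 - ‖q j‖ ^ 2)
          - l * inner ℝ g (q (j + 1)) + l * inner ℝ p (r (j + 1))) := by
      unfold defect
      change b (j + 1 + 1) * inner ℝ p' (q (j + 1 + 1)) - pivot a b (j + 1) *
        (‖q (j + 1)‖ ^ 2 - inner ℝ p' (q (j + 1))) = _
      rw [hloss, hp', inner_sub_left, real_inner_smul_left, hb, hθdef, hθ'def, he, ← hld]
      rw [← hld] at hsymm
      linear_combination l * hsymm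
    have hdN : l ^ 2 * d ≤ 4 * K * ‖p'‖ ^ 2 := by
      have : 4 * K * (1 / 2) ≤ 4 * K * N := by gcongr
      have : d ≤ 4 * K * N := by linarith
      calc l ^ 2 * d ≤ l ^ 2 * (4 * K * N) := by gcongr
        _ = 4 * K * (l ^ 2 * N) := by ring
        _ ≤ _ := by gcongr; linarith
    have t1 : |θ' - θ| ≤ 4 * δ * ‖p'‖ ^ 2 := by
      have := mul_le_mul_of_nonneg_left hhalf hδ0
      rw [abs_le]
      constructor <;> linarith
    have t2 : |l ^ 2 * d * (‖q (j + 1)‖ ^ 2 - ‖q j‖ ^ 2)| ≤ 8 * K * δ * ‖p'‖ ^ 2 := by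
      have : |‖q (j + 1)‖ ^ 2 - ‖q j‖ ^ 2| ≤ 2 * δ := by
        rw [abs_le]; constructor <;> linarith
      rw [abs_mul, abs_of_nonneg (by positivity : 0 ≤ l ^ 2 * d)]
      calc _ ≤ (4 * K * ‖p'‖ ^ 2) * (2 * δ) := by gcongr
        _ = _ := by ring
    have t3 : |l * inner ℝ g (q (j + 1))| ≤ 33 / 10 * δ * (j + 1) * ‖p'‖ ^ 2 := by
      rw [abs_mul]
      calc _ ≤ |l| * ((2 * δ * (j + 1) * ‖p‖) * (11 / 10)) := by
            gcongr
            exact (abs_real_inner_le_norm _ _).trans (by gcongr)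
        _ = 22 / 10 * δ * (j + 1) * (|l| * ‖p‖) := by ring
        _ ≤ 22 / 10 * δ * (j + 1) * (3 / 2 * ‖p'‖ ^ 2) :=
          mul_le_mul_of_nonneg_left (hlp.trans hpp) (by positivity)
        _ = _ := by ring
    have t4 : |l * inner ℝ p (r (j + 1))| ≤ 3 / 2 * δ * ‖p'‖ ^ 2 := by
      rw [abs_mul]
      calc _ ≤ |l| * (‖p‖ * δ) := by
            gcongr
            exact (abs_real_inner_le_norm _ _).trans (by gcongr)
        _ = δ * (|l| * ‖p‖) := by ring
        _ ≤ δ * (3 / 2 * ‖p'‖ ^ 2) := mul_le_mul_of_nonneg_left (hlp.trans hpp) hδ0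
        _ = _ := by ring
    have hkj : (j : ℝ) + 1 ≤ k := by exact_mod_cast hj.le
    have hk1 : (1 : ℝ) ≤ k := by
      have : (0 : ℝ) ≤ j := by positivity
      linarith
    have t5 : 4 * δ + 8 * K * δ + 33 / 10 * δ * (j + 1) + 3 / 2 * δ ≤ ν := by
      have e0 : (k : ℝ) ≤ K * k := le_mul_of_one_le_left (by linarith) hK
      have e1 : δ * 1 ≤ δ * (K * k) := mul_le_mul_of_nonneg_left (by linarith) hδ0
      have e2 : δ * (j + 1) ≤ δ * (K * k) := mul_le_mul_of_nonneg_left (by linarith) hδ0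
      have e3 : δ * K ≤ δ * (K * k) :=
        mul_le_mul_of_nonneg_left (le_mul_of_one_le_right (by linarith) hk1) hδ0
      rw [hν]
      linarith
    have t6 : |l ^ 2 * (b (j + 1) * inner ℝ p (q (j + 1)) -
        d * (‖q j‖ ^ 2 - inner ℝ p (q j)))| ≤ ν * (j + 1) * ‖p'‖ ^ 2 := by
      rw [abs_mul, abs_of_nonneg (sq_nonneg l)]
      calc _ ≤ l ^ 2 * (ν * (j + 1) * N) := by gcongr
        _ = ν * (j + 1) * (l ^ 2 * N) := by ring
        _ ≤ _ := by gcongr; linarith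
    have t7 := mul_le_mul_of_nonneg_right t5 (sq_nonneg ‖p'‖)
    rw [hnext, abs_le]
    rw [abs_le] at t1 t2 t3 t4 t6
    push_cast
    constructor <;> linarith
  · rw [hloss]; push_cast; exact he_bound

theorem pivot_le_diag {a b : ℕ → ℝ} {j : ℕ} (h : ∀ i < j, 0 < pivot a b i) :
    pivot a b j ≤ a j := by
  rcases j with _ | j
  · exact le_rfl
  · have := h j (by omega)
    have : 0 ≤ b (j + 1) ^ 2 / pivot a b j := by positivity
    simp only [pivot]
    linarith

/-- If `G ≥ 1`, then the tridiagonal matrix of a near recurrence for `G` is positive definite. -/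
theorem NearRecurrence.pivot_pos {G : E →ₗ[ℝ] E} (hsym : G.IsSymmetric) {a b : ℕ → ℝ}
    {q r : ℕ → E} {δ K : ℝ} {k : ℕ} (h : NearRecurrence G a b q r k δ) (hK : 1 ≤ K)
    (hG : ∀ x, ‖x‖ ^ 2 ≤ inner ℝ (G x) x) (hGK : ∀ x, inner ℝ (G x) x ≤ K * ‖x‖ ^ 2)
    (hsmall : 320 * K * k ^ 3 * δ ≤ 1) {j : ℕ} (hj : j < k) : 0 < pivot a b j := by
  have hδ0 : 0 ≤ δ := (norm_nonneg _).trans (h.err j hj)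
  have hk1 : (1 : ℝ) ≤ k := by exact_mod_cast (by omega : 1 ≤ k)
  set ν := 20 * K * k * δ with hν
  have hν0 : 0 ≤ ν := by positivity
  -- The constant 320 is chosen for this: the accumulated loss of orthogonality stays below `1/8`
  -- through all `k` steps.
  have hνk : 2 * ν * k ^ 2 ≤ 1 / 8 := by rw [hν]; linarith
  have hKk : 1 ≤ K * k ^ 3 := by
    have := one_le_pow₀ hk1 (n := 3)
    nlinarith
  have hδ : δ ≤ 1 / 100 := by nlinarith
  have hδk : 2 * δ * k ≤ 1 / 8 := by
    have : (k : ℝ) ≤ K * k ^ 3 := by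
      have := one_le_pow₀ hk1 (n := 2)
      have : (k : ℝ) ≤ k ^ 3 := by nlinarith
      nlinarith [pow_pos (by linarith : (0 : ℝ) < k) 3]
    have := mul_le_mul_of_nonneg_left this hδ0
    linarith
  have hle {j : ℕ} (hj : j < k) (hs : SweepBounds G a b q r δ ν j) :
      ‖sweep a b q j‖ ^ 2 ≤ 2 * pivot a b j := by
    have hjk : (j : ℝ) + 1 ≤ k := by exact_mod_cast hj
    refine hs.le_pivot hG ((h.unit j hj).trans (by linarith)) ?_ ?_
    · have : (j : ℝ) + 1 ≤ k ^ 2 := by nlinarith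
      nlinarith
    · exact (by gcongr : 2 * δ * (j + 1) ≤ 2 * δ * k).trans hδk
  -- Earlier pivots are carried along because their positivity bounds the current pivot by its
  -- diagonal entry, hence by `2 * K`.
  have main : ∀ j < k, (∀ i < j, 0 < pivot a b i) ∧ SweepBounds G a b q r δ ν j := by
    intro j
    induction j with
    | zero =>
      intro hj
      refine ⟨by simp, ?_⟩
      have hu := abs_le.mp (h.unit 0 hj)
      have hθ := h.orth 0 hj
      have hhalf : 1 / 2 ≤ ‖q 0‖ ^ 2 := by linarith
      constructor
      · exact hhalf
      · simpa [sweep, pivot, h.zero, add_comm, add_left_comm] using h.recur 0 hj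
      · have := h.err 0 hj
        simp only [sweep, Nat.cast_zero, zero_add, mul_one]
        have : 1 / 2 ≤ ‖q 0‖ := by nlinarith [norm_nonneg (q 0)]
        nlinarith
      · simp only [defect, sweep, real_inner_self_eq_norm_sq, sub_self, mul_zero, sub_zero,
          Nat.cast_zero, zero_add, mul_one]
        refine hθ.trans ?_
        have : δ ≤ δ * (K * k) := le_mul_of_one_le_right hδ0 (by nlinarith)
        rw [hν]
        nlinarith
      · simp [sweep]
    | succ j ih =>
      intro hj
      obtain ⟨h1, h2⟩ := ih (by omega)
      have h3 := hle (by omega) h2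
      have h4 := h2.half
      have h5 : ∀ i < j + 1, 0 < pivot a b i := by
        intro i hi
        rcases Nat.lt_succ_iff_lt_or_eq.mp hi with hi | rfl
        · exact h1 i hi
        · linarith
      refine ⟨h5, h.sweepBounds_succ hsym hj hδ hK hν ?_
        ((pivot_le_diag h1).trans (h.diag_le hδ hK hGK (by omega))) h3 h2⟩
      have hjk : (j : ℝ) + 1 ≤ k := by exact_mod_cast hj.le
      exact (by gcongr : 2 * ν * (j + 1) ^ 2 ≤ 2 * ν * k ^ 2).trans hνk
  have h2 := (main j hj).2
  linarith [h2.half, hle hj h2]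

end Pivots

/-! ### Quadratic forms and inverse decay of tridiagonal matrices -/

section TridiagonalForm

open Finset

/-- The quadratic form of the `(j + 1) × (j + 1)` symmetric tridiagonal matrix with diagonal
`a 0, …, a j` and off-diagonal entries `b 1, …, b j`. -/
def tridiagForm (a b : ℕ → ℝ) (j : ℕ) (x : ℕ → ℝ) : ℝ :=
  ∑ i ∈ range (j + 1), a i * x i ^ 2 + 2 * ∑ i ∈ range j, b (i + 1) * (x i * x (i + 1))

/-- Completing squares from the first variable onward leaves the last pivot as coefficient of the
last square. -/
theorem pivot_mul_sq_le_tridiagForm {a b : ℕ → ℝ} (x : ℕ → ℝ) (j : ℕ)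
    (h : ∀ i ≤ j, 0 < pivot a b i) : pivot a b j * x j ^ 2 ≤ tridiagForm a b j x := by
  induction j with
  | zero => simp [tridiagForm, pivot]
  | succ j ih =>
    have h1 := ih fun i hi => h i (by omega)
    have h2 := h j (by omega)
    have h3 : tridiagForm a b (j + 1) x = tridiagForm a b j x + a (j + 1) * x (j + 1) ^ 2 +
        2 * (b (j + 1) * (x j * x (j + 1))) := by
      simp only [tridiagForm]
      rw [sum_range_succ (fun i => a i * x i ^ 2) (j + 1),
        sum_range_succ (fun i => b (i + 1) * (x i * x (i + 1))) j]
      ring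
    have h4 : pivot a b j * (x j + b (j + 1) / pivot a b j * x (j + 1)) ^ 2 =
        pivot a b j * x j ^ 2 + 2 * (b (j + 1) * (x j * x (j + 1))) +
          b (j + 1) ^ 2 / pivot a b j * x (j + 1) ^ 2 := by
      field_simp
      ring
    have h5 : 0 ≤ pivot a b j * (x j + b (j + 1) / pivot a b j * x (j + 1)) ^ 2 := by positivity
    rw [h4] at h5
    simp only [h3, pivot, sub_mul]
    generalize b (j + 1) ^ 2 / pivot a b j * x (j + 1) ^ 2 = z at h5 ⊢
    linarith

theorem tridiagForm_shift_scale (a b : ℕ → ℝ) (μ σ : ℝ) (j : ℕ) (x : ℕ → ℝ) :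
    tridiagForm (fun i => σ * (a i - μ)) (fun i => σ * b i) j x =
      σ * (tridiagForm a b j x - μ * ∑ i ∈ range (j + 1), x i ^ 2) := by
  have h1 : ∑ i ∈ range (j + 1), σ * (a i - μ) * x i ^ 2 =
      σ * (∑ i ∈ range (j + 1), a i * x i ^ 2 - μ * ∑ i ∈ range (j + 1), x i ^ 2) := by
    rw [mul_sum, ← sum_sub_distrib, mul_sum]
    exact sum_congr rfl fun i _ => by ring
  have h2 : ∑ i ∈ range j, σ * b (i + 1) * (x i * x (i + 1)) =
      σ * ∑ i ∈ range j, b (i + 1) * (x i * x (i + 1)) := by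
    rw [mul_sum]
    exact sum_congr rfl fun i _ => by ring
  simp only [tridiagForm, h1, h2]
  ring

theorem sq_offDiag_le_of_pivot_pos {a b : ℕ → ℝ} {j : ℕ} (h : ∀ i ≤ j + 1, 0 < pivot a b i) :
    b (j + 1) ^ 2 ≤ a j * a (j + 1) := by
  have h1 := h j (by omega)
  have h2 := h (j + 1) le_rfl
  have h3 : pivot a b j ≤ a j := pivot_le_diag fun i hi => h i (by omega)
  simp only [pivot] at h2
  have h4 : b (j + 1) ^ 2 / pivot a b j ≤ a (j + 1) := (sub_pos.mp h2).le
  have h5 : 0 ≤ a (j + 1) := (div_nonneg (sq_nonneg _) h1.le).trans h4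
  rw [div_le_iff₀ h1] at h4
  nlinarith

/-- The identity behind the decay of solutions of tridiagonal systems. -/
theorem sum_weighted_tridiag {a b x : ℕ → ℝ} {j : ℕ} (hb : b 0 = 0) (hx : x (j + 1) = 0) (ρ : ℝ) :
    ∑ i ∈ range (j + 1),
        ρ ^ (2 * i) * x i * (b (i + 1) * x (i + 1) + a i * x i + b i * x (i - 1)) =
      tridiagForm a b j (fun i => ρ ^ i * x i) +
        (ρ - 1) ^ 2 * ∑ i ∈ range j, b (i + 1) * (ρ ^ (2 * i) * (x i * x (i + 1))) := by
  have h1 : ∑ i ∈ range (j + 1),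
      ρ ^ (2 * i) * x i * (b (i + 1) * x (i + 1) + a i * x i + b i * x (i - 1)) =
      ∑ i ∈ range (j + 1), b (i + 1) * (ρ ^ (2 * i) * (x i * x (i + 1))) +
        ∑ i ∈ range (j + 1), a i * (ρ ^ i * x i) ^ 2 +
        ∑ i ∈ range (j + 1), b i * (ρ ^ (2 * i) * (x i * x (i - 1))) := by
    rw [← sum_add_distrib, ← sum_add_distrib]
    exact sum_congr rfl fun i _ => by ring
  have h2 : ∑ i ∈ range (j + 1), b (i + 1) * (ρ ^ (2 * i) * (x i * x (i + 1))) =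
      ∑ i ∈ range j, b (i + 1) * (ρ ^ (2 * i) * (x i * x (i + 1))) := by
    rw [sum_range_succ, hx]; ring
  have h3 : ∑ i ∈ range (j + 1), b i * (ρ ^ (2 * i) * (x i * x (i - 1))) =
      ρ ^ 2 * ∑ i ∈ range j, b (i + 1) * (ρ ^ (2 * i) * (x i * x (i + 1))) := by
    rw [sum_range_succ', hb, mul_sum]
    simp only [Nat.add_sub_cancel, zero_mul, add_zero]
    exact sum_congr rfl fun i _ => by ring
  have h4 : ∑ i ∈ range j, b (i + 1) * (ρ ^ i * x i * (ρ ^ (i + 1) * x (i + 1))) =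
      ρ * ∑ i ∈ range j, b (i + 1) * (ρ ^ (2 * i) * (x i * x (i + 1))) := by
    rw [mul_sum]
    exact sum_congr rfl fun i _ => by ring
  rw [h1, h2, h3, tridiagForm, h4]
  ring

theorem sum_abs_mul_succ_le (u : ℕ → ℝ) (j : ℕ) :
    ∑ i ∈ range j, |u i * u (i + 1)| ≤ ∑ i ∈ range (j + 1), u i ^ 2 := by
  have h1 : ∑ i ∈ range j, |u i * u (i + 1)| ≤ ∑ i ∈ range j, (u i ^ 2 + u (i + 1) ^ 2) / 2 := by
    refine sum_le_sum fun i _ => ?_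
    rw [abs_le]
    constructor <;> nlinarith [sq_nonneg (u i - u (i + 1)), sq_nonneg (u i + u (i + 1))]
  have h2 : ∑ i ∈ range (j + 1), u i ^ 2 = ∑ i ∈ range j, u i ^ 2 + u j ^ 2 := sum_range_succ _ _
  have h3 : ∑ i ∈ range (j + 1), u i ^ 2 = ∑ i ∈ range j, u (i + 1) ^ 2 + u 0 ^ 2 :=
    sum_range_succ' _ _
  rw [← sum_div, sum_add_distrib] at h1
  nlinarith [sq_nonneg (u j), sq_nonneg (u 0)]

/-- Exponential decay of the first column of the inverse of a positive definite tridiagonal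
matrix. -/
theorem decay_of_tridiag_solution {a b x : ℕ → ℝ} {j : ℕ} {μ β c ρ : ℝ} (hb : b 0 = 0)
    (hx : x (j + 1) = 0) (hμ : ∀ y, μ * ∑ i ∈ range (j + 1), y i ^ 2 ≤ tridiagForm a b j y)
    (hβ : ∀ i < j, |b (i + 1)| ≤ β) (hβ0 : 0 ≤ β) (hρ : 1 ≤ ρ) (hc : 0 < c)
    (hcμ : c + β * (ρ - 1) ^ 2 ≤ μ)
    (hsol : ∀ i ≤ j, b (i + 1) * x (i + 1) + a i * x i + b i * x (i - 1) =
      if i = 0 then 1 else 0) :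
    c * (ρ ^ j * |x j|) ≤ 1 := by
  have h1 := sum_weighted_tridiag (a := a) hb hx ρ
  have h2 : ∑ i ∈ range (j + 1),
        ρ ^ (2 * i) * x i * (b (i + 1) * x (i + 1) + a i * x i + b i * x (i - 1)) = x 0 := by
    rw [sum_congr rfl fun i hi => by rw [hsol i (by simpa [Nat.lt_succ_iff] using hi)]]
    simp
  rw [h2] at h1
  have h3 := hμ fun i => ρ ^ i * x i
  set U := ∑ i ∈ range (j + 1), (ρ ^ i * x i) ^ 2 with hU
  have hU0 : 0 ≤ U := sum_nonneg fun i _ => sq_nonneg _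
  have h4 : |∑ i ∈ range j, b (i + 1) * (ρ ^ (2 * i) * (x i * x (i + 1)))| ≤ β * U := by
    calc _ ≤ ∑ i ∈ range j, |b (i + 1) * (ρ ^ (2 * i) * (x i * x (i + 1)))| :=
          abs_sum_le_sum_abs _ _
      _ ≤ ∑ i ∈ range j, β * |ρ ^ i * x i * (ρ ^ (i + 1) * x (i + 1))| := by
        refine sum_le_sum fun i hi => ?_
        rw [abs_mul]
        refine mul_le_mul (hβ i (mem_range.mp hi)) ?_ (abs_nonneg _) hβ0
        have : ρ ^ i * x i * (ρ ^ (i + 1) * x (i + 1)) =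
            ρ * (ρ ^ (2 * i) * (x i * x (i + 1))) := by ring
        rw [this, abs_mul ρ, abs_of_nonneg (zero_le_one.trans hρ)]
        exact le_mul_of_one_le_left (abs_nonneg _) hρ
      _ ≤ β * U := by
        rw [← mul_sum]
        exact mul_le_mul_of_nonneg_left (sum_abs_mul_succ_le (fun i => ρ ^ i * x i) j) hβ0
  -- The right-hand side `e₁` meets the weight only at index `0`, where it equals one. Together with
  -- `x 0 ^ 2 ≤ U` this closes up to `c ^ 2 * U ≤ 1`, and the last summand of `U` gives the decay.
  have h5 : c * U ≤ x 0 := by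
    have h6 := mul_le_mul_of_nonneg_left (abs_le.mp h4).1 (sq_nonneg (ρ - 1))
    have h7 := mul_le_mul_of_nonneg_right hcμ hU0
    linarith
  have hmem {i : ℕ} (hi : i ∈ range (j + 1)) : (ρ ^ i * x i) ^ 2 ≤ U :=
    single_le_sum (f := fun i => (ρ ^ i * x i) ^ 2) (fun i _ => sq_nonneg _) hi
  have h8 : x 0 ^ 2 ≤ U := by simpa using hmem (i := 0) (by simp)
  have h9 : c ^ 2 * U ≤ 1 := by
    rcases hU0.eq_or_lt with h | h
    · rw [← h]; norm_num
    · have : (c * U) ^ 2 ≤ x 0 ^ 2 := pow_le_pow_left₀ (by positivity) h5 2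
      have : c ^ 2 * U * U ≤ 1 * U := by linarith
      exact le_of_mul_le_mul_right this h
  have h10 : (ρ ^ j * x j) ^ 2 ≤ U := hmem (by simp)
  have h11 : |c * (ρ ^ j * x j)| ≤ 1 := by
    rw [← sq_le_one_iff_abs_le_one]
    calc _ = c ^ 2 * (ρ ^ j * x j) ^ 2 := by ring
      _ ≤ c ^ 2 * U := by gcongr
      _ ≤ 1 := h9
  rwa [abs_mul, abs_mul, abs_of_pos hc, abs_of_nonneg (by positivity : 0 ≤ ρ ^ j)] at h11

end TridiagonalForm

/-! ### Lanczos recurrences with an inexact preconditioner -/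

section Perturbed

variable {E : Type*} [NormedAddCommGroup E] [InnerProductSpace ℝ E]

/-- The data of a Lanczos iteration for `B` of length `k` in which the vectors `p i` only
approximate the vectors `q i`. -/
structure PerturbedLanczos (B : E →ₗ[ℝ] E) (α β : ℕ → ℝ) (q p : ℕ → E) (k : ℕ) (ε₀ : ℝ) :
    Prop where
  beta_zero : β 0 = 0
  recur : ∀ i < k, B (p i) = β (i + 1) • q (i + 1) + α i • q i + β i • q (i - 1)
  near : ∀ i < k, ‖p i - q i‖ ≤ ε₀ * ‖q i‖
  unit : ∀ i < k, inner ℝ (q i) (p i) = 1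
  orth : ∀ i < k, β (i + 1) * inner ℝ (q (i + 1)) (p i) = 0

theorem abs_norm_sq_sub_one_le {q p : E} {ε₀ : ℝ} (h : inner ℝ q p = 1)
    (hn : ‖p - q‖ ≤ ε₀ * ‖q‖) (hε : ε₀ ≤ 1 / 2) : |‖q‖ ^ 2 - 1| ≤ 2 * ε₀ := by
  have h1 : inner ℝ q (p - q) = 1 - ‖q‖ ^ 2 := by
    rw [inner_sub_right, h, real_inner_self_eq_norm_sq]
  have h2 : |1 - ‖q‖ ^ 2| ≤ ε₀ * ‖q‖ ^ 2 := by
    rw [← h1]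
    calc _ ≤ ‖q‖ * ‖p - q‖ := abs_real_inner_le_norm _ _
      _ ≤ ‖q‖ * (ε₀ * ‖q‖) := by gcongr
      _ = _ := by ring
  have hq : 0 < ‖q‖ := by
    rw [norm_pos_iff]
    rintro rfl
    simp at h
  have hε0 : 0 ≤ ε₀ := by
    have := (norm_nonneg _).trans hn
    exact nonneg_of_mul_nonneg_left this hq
  have h3 := abs_le.mp h2
  have h4 : ‖q‖ ^ 2 ≤ 2 := by nlinarith
  rw [abs_sub_comm]
  nlinarith

/-- For `‖q‖² ≤ 2` the map `u ↦ u - ⟨u, q⟩ q` does not increase norms; replacing `q` by `p` in the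
functional costs `2 ε₀`. -/
theorem norm_sub_inner_smul_le {q p : E} {ε₀ : ℝ} (h : inner ℝ q p = 1)
    (hn : ‖p - q‖ ≤ ε₀ * ‖q‖) (hε : ε₀ ≤ 1 / 2) (u : E) :
    ‖u - (inner ℝ u p : ℝ) • q‖ ≤ (1 + 2 * ε₀) * ‖u‖ := by
  have hq := abs_le.mp (abs_norm_sq_sub_one_le h hn hε)
  have h4 : ‖q‖ ^ 2 ≤ 2 := by linarith
  have h1 : u - (inner ℝ u p : ℝ) • q =
      (u - (inner ℝ u q : ℝ) • q) - (inner ℝ u (p - q) : ℝ) • q := by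
    rw [inner_sub_right]; module
  have h2 : ‖u - (inner ℝ u q : ℝ) • q‖ ≤ ‖u‖ := by
    refine (pow_le_pow_iff_left₀ (norm_nonneg _) (norm_nonneg _) two_ne_zero).mp ?_
    rw [norm_sub_sq_real, inner_smul_right, norm_smul, mul_pow, Real.norm_eq_abs, sq_abs]
    nlinarith [mul_nonneg (sq_nonneg (inner ℝ u q : ℝ)) (by linarith : 0 ≤ 2 - ‖q‖ ^ 2)]
  have h3 : ‖(inner ℝ u (p - q) : ℝ) • q‖ ≤ 2 * ε₀ * ‖u‖ := by
    rw [norm_smul, Real.norm_eq_abs]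
    have hε0 : 0 ≤ ε₀ := by linarith
    calc _ ≤ (‖u‖ * (ε₀ * ‖q‖)) * ‖q‖ := by
          gcongr
          exact (abs_real_inner_le_norm _ _).trans (by gcongr)
      _ = ε₀ * ‖u‖ * ‖q‖ ^ 2 := by ring
      _ ≤ ε₀ * ‖u‖ * 2 := by gcongr
      _ = _ := by ring
  rw [h1]
  calc _ ≤ _ := norm_sub_le _ _
    _ ≤ ‖u‖ + 2 * ε₀ * ‖u‖ := add_le_add h2 h3
    _ = _ := by ring

namespace PerturbedLanczos

variable {B : E →ₗ[ℝ] E} {α β : ℕ → ℝ} {q p : ℕ → E} {k : ℕ} {ε₀ : ℝ}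

theorem norm_sq (h : PerturbedLanczos B α β q p k ε₀) (hε : ε₀ ≤ 1 / 100) {i : ℕ} (hi : i < k) :
    |‖q i‖ ^ 2 - 1| ≤ 2 * ε₀ :=
  abs_norm_sq_sub_one_le (h.unit i hi) (h.near i hi) (by linarith)

theorem norm_le (h : PerturbedLanczos B α β q p k ε₀) (hε : ε₀ ≤ 1 / 100) {i : ℕ} (hi : i < k) :
    ‖q i‖ ≤ 101 / 100 := by
  refine (pow_le_pow_iff_left₀ (norm_nonneg _) (by norm_num) two_ne_zero).mp ?_
  linarith [(abs_le.mp (h.norm_sq hε hi)).2]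

theorem le_norm (h : PerturbedLanczos B α β q p k ε₀) (hε : ε₀ ≤ 1 / 100) {i : ℕ} (hi : i < k) :
    98 / 100 ≤ ‖q i‖ := by
  refine (pow_le_pow_iff_left₀ (by norm_num) (norm_nonneg _) two_ne_zero).mp ?_
  linarith [(abs_le.mp (h.norm_sq hε hi)).1]

/-- A crude a priori bound, linear in the index: each new vector is a nearly nonexpansive oblique
projection of `B (p i) - β i • q (i - 1)`. It is needed to turn `q (i + 1) ⊥ p i` into
near-orthogonality to `q i`, before any spectral information on `T'` exists. -/
theorem norm_beta_smul_le (h : PerturbedLanczos B α β q p k ε₀) {Λ : ℝ} (hΛ : 0 ≤ Λ)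
    (hB : ∀ x, ‖B x‖ ≤ Λ * ‖x‖) (hε0 : 0 ≤ ε₀) (hε : 100 * k * ε₀ ≤ 1) {i : ℕ} (hi : i < k) :
    ‖β (i + 1) • q (i + 1)‖ ≤ 4 * Λ * (i + 1) := by
  have hk1 : (1 : ℝ) ≤ k := by exact_mod_cast (by omega : 1 ≤ k)
  have hε' : ε₀ ≤ 1 / 100 := by nlinarith
  have step : ∀ i < k, ‖β (i + 1) • q (i + 1)‖ ≤
      (1 + 2 * ε₀) * (11 / 10 * Λ + ‖β i • q (i - 1)‖) := by
    intro i hi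
    have h1 : β (i + 1) • q (i + 1) =
        (B (p i) - β i • q (i - 1)) - (inner ℝ (B (p i) - β i • q (i - 1)) (p i) : ℝ) • q i := by
      have e1 : B (p i) - β i • q (i - 1) = β (i + 1) • q (i + 1) + α i • q i := by
        rw [h.recur i hi]; abel
      have e2 : (inner ℝ (B (p i) - β i • q (i - 1)) (p i) : ℝ) = α i := by
        rw [e1, inner_add_left, real_inner_smul_left, real_inner_smul_left, h.orth i hi,
          h.unit i hi]
        ring
      rw [e2, e1]; abel
    rw [h1]
    refine (norm_sub_inner_smul_le (h.unit i hi) (h.near i hi) (by linarith) _).trans ?_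
    gcongr
    refine (norm_sub_le _ _).trans ?_
    gcongr
    refine (hB _).trans ?_
    rw [mul_comm]
    gcongr
    calc ‖p i‖ = ‖(p i - q i) + q i‖ := by rw [sub_add_cancel]
      _ ≤ ‖p i - q i‖ + ‖q i‖ := norm_add_le _ _
      _ ≤ ε₀ * ‖q i‖ + ‖q i‖ := by gcongr; exact h.near i hi
      _ ≤ 11 / 10 := by nlinarith [h.norm_le hε' hi, norm_nonneg (q i)]
  induction i with
  | zero =>
    have h1 := step 0 hi
    rw [h.beta_zero, zero_smul, norm_zero, add_zero] at h1
    refine h1.trans ?_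
    push_cast
    nlinarith
  | succ i ih =>
    have h1 := step (i + 1) hi
    have h2 := ih (by omega)
    -- The induction hypothesis concerns `β (i + 1) • q (i + 1)`, while the recurrence contains `β
    -- (i + 1) • q i`. Both vectors have nearly unit length, so the exchange is cheap.
    have h3 : ‖q i‖ ≤ (1 + 4 * ε₀) * ‖q (i + 1)‖ := by
      refine (pow_le_pow_iff_left₀ (norm_nonneg _) (by positivity) two_ne_zero).mp ?_
      have e1 := abs_le.mp (h.norm_sq hε' (i := i) (by omega))
      have e2 := abs_le.mp (h.norm_sq hε' hi)
      have e3 : (1 + 8 * ε₀) * (1 - 2 * ε₀) ≤ (1 + 4 * ε₀) ^ 2 * ‖q (i + 1)‖ ^ 2 := by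
        gcongr
        · linarith
        · nlinarith
        · linarith
      nlinarith
    have h4 : ‖β (i + 1) • q i‖ ≤ (1 + 4 * ε₀) * (4 * Λ * (i + 1)) := by
      rw [norm_smul] at h2 ⊢
      calc _ ≤ ‖β (i + 1)‖ * ((1 + 4 * ε₀) * ‖q (i + 1)‖) := by gcongr
        _ = (1 + 4 * ε₀) * (‖β (i + 1)‖ * ‖q (i + 1)‖) := by ring
        _ ≤ _ := by gcongr
    rw [Nat.add_sub_cancel] at h1
    have hik : (i : ℝ) + 1 ≤ k := by exact_mod_cast hi.le
    have h5 : ε₀ * (i + 1) ≤ 1 / 100 := by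
      have := mul_le_mul_of_nonneg_left hik hε0
      linarith
    have h6 : (1 + 2 * ε₀) * (1 + 4 * ε₀) ≤ 1 + 7 * ε₀ := by nlinarith
    calc _ ≤ (1 + 2 * ε₀) * (11 / 10 * Λ + (1 + 4 * ε₀) * (4 * Λ * (i + 1))) := by
          refine h1.trans ?_
          gcongr
      _ = (1 + 2 * ε₀) * (11 / 10) * Λ + ((1 + 2 * ε₀) * (1 + 4 * ε₀)) * (4 * Λ * (i + 1)) := by
        ring
      _ ≤ (12 / 10) * Λ + (1 + 7 * ε₀) * (4 * Λ * (i + 1)) := by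
        gcongr
        linarith
      _ = 12 / 10 * Λ + 28 * (ε₀ * (i + 1)) * Λ + 4 * Λ * (i + 1) := by ring
      _ ≤ 12 / 10 * Λ + 28 * (1 / 100) * Λ + 4 * Λ * (i + 1) := by gcongr
      _ ≤ _ := by push_cast; linarith

/-- Replacing `B (p i)` by `B (q i)` moves the preconditioner error into the recurrence remainder; a
shift and scaling then act on both the operator and the coefficients. -/
theorem nearRecurrence (h : PerturbedLanczos B α β q p k ε₀) {Λ : ℝ} (hΛ : 0 ≤ Λ)
    (hB : ∀ x, ‖B x‖ ≤ Λ * ‖x‖) (hε0 : 0 ≤ ε₀) (hε : 100 * k * ε₀ ≤ 1) (σ μ : ℝ)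
    (hσ : 1 ≤ |σ| * Λ) :
    NearRecurrence (σ • (B - μ • LinearMap.id)) (fun i => σ * (α i - μ)) (fun i => σ * β i) q
      (fun i => -(σ • B (p i - q i))) k (5 * (|σ| * Λ) * k * ε₀) := by
  have hk1 {i : ℕ} (hi : i < k) : (1 : ℝ) ≤ k := by exact_mod_cast (by omega : 1 ≤ k)
  have hε' {i : ℕ} (hi : i < k) : ε₀ ≤ 1 / 100 := by nlinarith [hk1 hi]
  constructor
  · simp [h.beta_zero]
  · intro i hi
    have e := h.recur i hi
    have e2 : B (q i) = β (i + 1) • q (i + 1) + α i • q i + β i • q (i - 1) - B (p i - q i) := by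
      rw [map_sub, ← e]; abel
    simp only [LinearMap.smul_apply, LinearMap.sub_apply, LinearMap.id_apply]
    rw [e2]
    module
  · intro i hi
    rw [norm_neg, norm_smul, Real.norm_eq_abs]
    calc _ ≤ |σ| * (Λ * (ε₀ * ‖q i‖)) := by
          gcongr
          refine (hB _).trans ?_
          gcongr
          exact h.near i hi
      _ ≤ |σ| * (Λ * (ε₀ * 2)) := by
        gcongr
        linarith [h.norm_le (hε' hi) hi]
      _ = 2 * (|σ| * Λ) * 1 * ε₀ := by ring
      _ ≤ _ := by
        gcongr
        · norm_num
        · exact hk1 hi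
  · intro i hi
    refine (h.norm_sq (hε' hi) hi).trans ?_
    gcongr
    nlinarith [hk1 hi]
  · intro i hi
    have e1 : β (i + 1) * inner ℝ (q i) (q (i + 1)) =
        -inner ℝ (β (i + 1) • q (i + 1)) (p i - q i) := by
      rw [real_inner_smul_left, inner_sub_right, mul_sub, h.orth i hi, real_inner_comm]
      ring
    have hik : (i : ℝ) + 1 ≤ k := by exact_mod_cast hi
    rw [mul_assoc, e1, abs_mul, abs_neg]
    calc _ ≤ |σ| * ((4 * Λ * (i + 1)) * (ε₀ * ‖q i‖)) := by
          gcongr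
          refine (abs_real_inner_le_norm _ _).trans ?_
          gcongr
          · exact h.norm_beta_smul_le hΛ hB hε0 hε hi
          · exact h.near i hi
      _ ≤ |σ| * ((4 * Λ * k) * (ε₀ * (5 / 4))) := by
        gcongr
        linarith [h.norm_le (hε' hi) hi]
      _ = _ := by ring

/-- Pivots of a shifted and scaled Lanczos matrix are positive as soon as the equally shifted
and scaled operator is at least `1`. -/
theorem pivot_pos (h : PerturbedLanczos B α β q p k ε₀) (hsym : B.IsSymmetric) {m Λ : ℝ}
    (hm : 0 < m) (hmΛ : m ≤ Λ) (hB : ∀ x, ‖B x‖ ≤ Λ * ‖x‖) (hε0 : 0 ≤ ε₀)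
    (hε : 160000 * (Λ / m) ^ 2 * k ^ 4 * ε₀ ≤ 1) {σ μ : ℝ} (hσ : |σ| = 10 / m)
    (hlo : ∀ x, ‖x‖ ^ 2 ≤ σ * (inner ℝ (B x) x - μ * ‖x‖ ^ 2))
    (hhi : ∀ x, σ * (inner ℝ (B x) x - μ * ‖x‖ ^ 2) ≤ 10 * (Λ / m) * ‖x‖ ^ 2) {j : ℕ}
    (hj : j < k) : 0 < pivot (fun i => σ * (α i - μ)) (fun i => σ * β i) j := by
  have hκ : 1 ≤ Λ / m := (one_le_div hm).mpr hmΛ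
  have hk1 : (1 : ℝ) ≤ k := by exact_mod_cast (by omega : 1 ≤ k)
  have hε' : 100 * k * ε₀ ≤ 1 := by
    refine le_trans ?_ hε
    have h1 : (1 : ℝ) ≤ (Λ / m) ^ 2 := one_le_pow₀ hκ
    have h2 : (k : ℝ) ≤ k ^ 4 := le_self_pow₀ hk1 (by norm_num)
    gcongr
    nlinarith
  have hσΛ : |σ| * Λ = 10 * (Λ / m) := by rw [hσ]; ring
  have hinner (x : E) : inner ℝ ((σ • (B - μ • LinearMap.id) : E →ₗ[ℝ] E) x) x =
      σ * (inner ℝ (B x) x - μ * ‖x‖ ^ 2) := by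
    simp only [LinearMap.smul_apply, LinearMap.sub_apply, LinearMap.id_apply]
    rw [real_inner_smul_left, inner_sub_left, real_inner_smul_left, real_inner_self_eq_norm_sq]
  have hnr := h.nearRecurrence (hm.le.trans hmΛ) hB hε0 hε' σ μ (by rw [hσΛ]; linarith)
  refine hnr.pivot_pos ?_ (K := 10 * (Λ / m)) (by linarith) ?_ ?_ ?_ hj
  · intro x y
    simp only [LinearMap.smul_apply, LinearMap.sub_apply, LinearMap.id_apply]
    rw [real_inner_smul_left, real_inner_smul_right, inner_sub_left, inner_sub_right, hsym x y,
      real_inner_smul_left, real_inner_smul_right]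
  · intro x; rw [hinner]; exact hlo x
  · intro x; rw [hinner]; exact hhi x
  -- With `K = 10 Λ / m` and `δ = 50 (Λ / m) k ε₀`, the product `320 K k³ δ` is the source of
  -- `160000 (Λ / m)² k⁴ ε₀`.
  · rw [hσΛ]
    refine le_trans (le_of_eq ?_) hε
    ring

section Spectrum

variable {m Λ : ℝ}

theorem pivot_pos_lower (h : PerturbedLanczos B α β q p k ε₀) (hsym : B.IsSymmetric)
    (hm : 0 < m) (hmΛ : m ≤ Λ) (hlow : ∀ x, m * ‖x‖ ^ 2 ≤ inner ℝ (B x) x)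
    (hB : ∀ x, ‖B x‖ ≤ Λ * ‖x‖) (hε0 : 0 ≤ ε₀)
    (hε : 160000 * (Λ / m) ^ 2 * k ^ 4 * ε₀ ≤ 1) {j : ℕ} (hj : j < k) :
    0 < pivot (fun i => 10 / m * (α i - 9 / 10 * m)) (fun i => 10 / m * β i) j := by
  have hup (x : E) : inner ℝ (B x) x ≤ Λ * ‖x‖ ^ 2 := by
    calc _ ≤ ‖B x‖ * ‖x‖ := real_inner_le_norm _ _
      _ ≤ Λ * ‖x‖ * ‖x‖ := by gcongr; exact hB x
      _ = _ := by ring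
  refine h.pivot_pos hsym hm hmΛ hB hε0 hε (abs_of_pos (by positivity)) ?_ ?_ hj
  · intro x
    rw [div_mul_eq_mul_div, le_div_iff₀ hm]
    linarith [hlow x]
  · intro x
    have : (10 * (Λ / m)) * ‖x‖ ^ 2 = 10 * (Λ * ‖x‖ ^ 2) / m := by ring
    rw [this, div_mul_eq_mul_div]
    gcongr
    nlinarith [hup x, sq_nonneg ‖x‖]

theorem pivot_pos_upper (h : PerturbedLanczos B α β q p k ε₀) (hsym : B.IsSymmetric)
    (hm : 0 < m) (hmΛ : m ≤ Λ) (hlow : ∀ x, m * ‖x‖ ^ 2 ≤ inner ℝ (B x) x)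
    (hB : ∀ x, ‖B x‖ ≤ Λ * ‖x‖) (hε0 : 0 ≤ ε₀)
    (hε : 160000 * (Λ / m) ^ 2 * k ^ 4 * ε₀ ≤ 1) {j : ℕ} (hj : j < k) :
    0 < pivot (fun i => -(10 / m) * (α i - (Λ + m / 10))) (fun i => -(10 / m) * β i) j := by
  have hup (x : E) : inner ℝ (B x) x ≤ Λ * ‖x‖ ^ 2 := by
    calc _ ≤ ‖B x‖ * ‖x‖ := real_inner_le_norm _ _
      _ ≤ Λ * ‖x‖ * ‖x‖ := by gcongr; exact hB x
      _ = _ := by ring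
  have key (y : ℝ) : -(10 / m) * y = 10 * (-y) / m := by ring
  refine h.pivot_pos hsym hm hmΛ hB hε0 hε
    (by rw [abs_neg]; exact abs_of_pos (by positivity)) ?_ ?_ hj
  · intro x
    rw [key, le_div_iff₀ hm]
    linarith [hup x]
  · intro x
    have : (10 * (Λ / m)) * ‖x‖ ^ 2 = 10 * (Λ * ‖x‖ ^ 2) / m := by ring
    rw [this, key]
    gcongr
    nlinarith [hlow x, sq_nonneg ‖x‖]

theorem le_tridiagForm (h : PerturbedLanczos B α β q p k ε₀) (hsym : B.IsSymmetric)
    (hm : 0 < m) (hmΛ : m ≤ Λ) (hlow : ∀ x, m * ‖x‖ ^ 2 ≤ inner ℝ (B x) x)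
    (hB : ∀ x, ‖B x‖ ≤ Λ * ‖x‖) (hε0 : 0 ≤ ε₀)
    (hε : 160000 * (Λ / m) ^ 2 * k ^ 4 * ε₀ ≤ 1) {j : ℕ} (hj : j < k) (x : ℕ → ℝ) :
    9 / 10 * m * ∑ i ∈ Finset.range (j + 1), x i ^ 2 ≤ tridiagForm α β j x := by
  have h1 := pivot_mul_sq_le_tridiagForm x j fun i hi =>
    h.pivot_pos_lower hsym hm hmΛ hlow hB hε0 hε (hi.trans_lt hj)
  rw [tridiagForm_shift_scale] at h1
  have h2 := h.pivot_pos_lower hsym hm hmΛ hlow hB hε0 hε hj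
  have h3 : 0 ≤ 10 / m * (tridiagForm α β j x -
      9 / 10 * m * ∑ i ∈ Finset.range (j + 1), x i ^ 2) :=
    le_trans (by positivity) h1
  have h4 := nonneg_of_mul_nonneg_right h3 (by positivity)
  linarith

/-- The `2 × 2` minors of `T' - 9/10 m` and of `Λ + m/10 - T'` bound `2 |β|` by the respective
diagonal sums. Adding the two cancels the `α`s. The gain `-4/5 m` over `Λ / 2` matters when `κ` and
`ε` are near one. -/
theorem abs_beta_le (h : PerturbedLanczos B α β q p k ε₀) (hsym : B.IsSymmetric)
    (hm : 0 < m) (hmΛ : m ≤ Λ) (hlow : ∀ x, m * ‖x‖ ^ 2 ≤ inner ℝ (B x) x)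
    (hB : ∀ x, ‖B x‖ ≤ Λ * ‖x‖) (hε0 : 0 ≤ ε₀)
    (hε : 160000 * (Λ / m) ^ 2 * k ^ 4 * ε₀ ≤ 1) {j : ℕ} (hj : j + 1 < k) :
    |β (j + 1)| ≤ (Λ - 4 / 5 * m) / 2 := by
  have l0 (i : ℕ) (hi : i ≤ j + 1) :=
    h.pivot_pos_lower hsym hm hmΛ hlow hB hε0 hε (hi.trans_lt hj)
  have u0 (i : ℕ) (hi : i ≤ j + 1) :=
    h.pivot_pos_upper hsym hm hmΛ hlow hB hε0 hε (hi.trans_lt hj)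
  have l1 := sq_offDiag_le_of_pivot_pos l0
  have u1 := sq_offDiag_le_of_pivot_pos u0
  have l2 (i : ℕ) (hi : i ≤ j + 1) := (l0 i hi).trans_le
    (pivot_le_diag fun i' hi' => l0 i' (by omega))
  have u2 (i : ℕ) (hi : i ≤ j + 1) := (u0 i hi).trans_le
    (pivot_le_diag fun i' hi' => u0 i' (by omega))
  have hs : 0 < (10 / m) ^ 2 := by positivity
  have amgm {x y z : ℝ} (hx : 0 ≤ x) (hy : 0 ≤ y) (h : z ^ 2 ≤ x * y) : 2 * |z| ≤ x + y := by
    refine (pow_le_pow_iff_left₀ (by positivity) (by positivity) two_ne_zero).mp ?_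
    rw [mul_pow, sq_abs]
    nlinarith [sq_nonneg (x - y)]
  have hp : 0 < 10 / m := by positivity
  have l3 := amgm (l2 j (by omega)).le (l2 (j + 1) le_rfl).le l1
  have u3 := amgm (u2 j (by omega)).le (u2 (j + 1) le_rfl).le u1
  rw [abs_mul, abs_of_pos hp] at l3
  rw [abs_mul, abs_neg, abs_of_pos hp] at u3
  have h1 : 10 / m * (4 * |β (j + 1)|) ≤ 10 / m * (2 * (Λ - 4 / 5 * m)) := by linarith
  have h2 := le_of_mul_le_mul_left h1 hp
  linarith

end Spectrum

end PerturbedLanczos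

end Perturbed

/-! ### Iteration count and precision -/

section Numerics

open Real

/-- Since `log (1 + 1 / (2 √κ)) ≥ 1 / (3 √κ)`, the factor 24 yields the exponent 8. -/
theorem le_pow_numIter_of_large {κ ε : ℝ} (hκ : 1 ≤ κ) (hε0 : 0 < ε) (hR : 11 / 10 < κ / ε) {t : ℕ}
    (ht : 24 * (√κ * log (κ / ε)) ≤ t) : (κ / ε) ^ 8 ≤ (1 + 1 / (2 * √κ)) ^ t := by
  have hs : 1 ≤ √κ := one_le_sqrt.mpr hκ
  have hR0 : 0 < κ / ε := by linarith
  have hρ0 : 0 < 1 + 1 / (2 * √κ) := by positivity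
  have h1 : 1 / (3 * √κ) ≤ log (1 + 1 / (2 * √κ)) := by
    refine le_trans ?_ (one_sub_inv_le_log_of_pos hρ0)
    have : 1 - (1 + 1 / (2 * √κ))⁻¹ = 1 / (2 * √κ + 1) := by field_simp; ring
    rw [this]
    exact one_div_le_one_div_of_le (by positivity) (by linarith)
  have hlog : 0 ≤ log (κ / ε) := log_nonneg (by linarith)
  rw [← log_le_log_iff (by positivity) (by positivity), log_pow, log_pow]
  calc ((8 : ℕ) : ℝ) * log (κ / ε) = 24 * (√κ * log (κ / ε)) * (1 / (3 * √κ)) := by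
        field_simp; norm_num; ring
    _ ≤ t * log (1 + 1 / (2 * √κ)) := by gcongr

/-- After `24 √κ log (κ / ε)` steps the decay rate `1 + 1 / (2 √κ)` beats `κ² / ε`. -/
theorem le_pow_numIter {κ ε : ℝ} (hκ : 1 ≤ κ) (hε0 : 0 < ε) (hε1 : ε < 1) {t : ℕ}
    (ht : 24 * (√κ * log (κ / ε)) ≤ t) :
    11 / 10 * (κ * (κ - 4 / 5)) ≤ ε * (1 + 1 / (2 * √κ)) ^ (t - 1) := by
  have hs : 1 ≤ √κ := one_le_sqrt.mpr hκ
  have hρ1 : 1 ≤ 1 + 1 / (2 * √κ) := le_add_of_nonneg_right (by positivity)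
  have hρ2 : 1 + 1 / (2 * √κ) ≤ 3 / 2 := by
    have : 1 / (2 * √κ) ≤ 1 / 2 := one_div_le_one_div_of_le (by norm_num) (by linarith)
    linarith
  set ρ := 1 + 1 / (2 * √κ) with hρ
  -- Here `t` may be as small as one and no decay is available; the factor `κ - 4/5 ≤ 3/10` alone
  -- suffices. In the other case `(11/10) ^ 6` pays for the constants and for the one missing step
  -- in `t - 1`.
  by_cases hR : κ / ε ≤ 11 / 10
  · rw [div_le_iff₀ hε0] at hR
    have h1 : κ ≤ 11 / 10 := by linarith
    have h2 : 10 / 11 ≤ ε := by linarith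
    have h3 : 1 ≤ ρ ^ (t - 1) := one_le_pow₀ hρ1
    have h4 : κ * (κ - 4 / 5) ≤ 11 / 10 * (3 / 10) := by
      apply mul_le_mul h1 <;> linarith
    have h5 : 10 / 11 * 1 ≤ ε * ρ ^ (t - 1) := by gcongr
    linarith
  · push Not at hR
    have h1 := le_pow_numIter_of_large hκ hε0 hR ht
    rw [← hρ] at h1
    have h2 : ρ ^ t ≤ 3 / 2 * ρ ^ (t - 1) := by
      rcases t with _ | t
      · simp; norm_num
      · rw [Nat.add_sub_cancel, pow_succ, mul_comm]
        gcongr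
    have hR1 : 1 ≤ κ / ε := by linarith
    have h3 : (165 / 100) * (κ / ε) ^ 2 ≤ (κ / ε) ^ 8 := by
      have : (11 / 10 : ℝ) ^ 6 ≤ (κ / ε) ^ 6 := by gcongr
      have h6 : (165 / 100 : ℝ) ≤ (κ / ε) ^ 6 := le_trans (by norm_num) this
      calc _ ≤ (κ / ε) ^ 6 * (κ / ε) ^ 2 := by gcongr
        _ = _ := by ring
    have h4 : 11 / 10 * (κ / ε) ^ 2 ≤ ρ ^ (t - 1) := by linarith
    have h5 : κ ^ 2 ≤ ε * (κ / ε) ^ 2 := by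
      have : ε * (κ / ε) ^ 2 = κ ^ 2 / ε := by field_simp
      rw [this, le_div_iff₀ hε0]
      nlinarith [sq_nonneg κ]
    have h6 := mul_le_mul_of_nonneg_left h4 hε0.le
    have h7 : κ * (κ - 4 / 5) ≤ κ ^ 2 := by nlinarith
    linarith

/-- With `R = κ / ε`, the left side without `ε₀` is a constant times `R ^ 10`. Since `n ≥ 2`, 90
powers of `R * n ≥ 2` pay for the constant. For `n = 1` this base can be close to one, so that
dimension is handled separately. -/
theorem precision_bound {κ ε ε₀ : ℝ} {n t : ℕ} (hκ : 1 ≤ κ) (hε0 : 0 < ε) (hε1 : ε < 1)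
    (hn : 2 ≤ n) (hε₀ : 0 ≤ ε₀) (h : ε₀ ≤ (ε / (κ * n)) ^ (100 : ℝ))
    (ht : t = ⌈24 * (√κ * log (κ / ε))⌉₊) : 160000 * κ ^ 2 * ((t : ℝ) + 1) ^ 4 * ε₀ ≤ 1 := by
  have hR : 1 ≤ κ / ε := by rw [le_div_iff₀ hε0]; linarith
  have hκR : κ ≤ κ / ε := by
    rw [le_div_iff₀ hε0]
    nlinarith
  set R := κ / ε with hRdef
  have hlog0 : 0 ≤ log R := log_nonneg hR
  have hlog : log R ≤ R := (log_le_sub_one_of_pos (by linarith)).trans (by linarith)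
  have hsqrt : √κ ≤ R := (sqrt_le_iff.mpr ⟨by linarith, by nlinarith⟩ : √κ ≤ κ).trans hκR
  have ht1 : (t : ℝ) + 1 ≤ 26 * R ^ 2 := by
    have h1 : (t : ℝ) < 24 * (√κ * log R) + 1 := by
      rw [ht]
      exact Nat.ceil_lt_add_one (by positivity)
    have h2 : √κ * log R ≤ R * R := by gcongr
    nlinarith
  have hn2 : (2 : ℝ) ≤ n := by exact_mod_cast hn
  have hx : ε / (κ * n) = 1 / (R * n) := by
    rw [hRdef]; field_simp
  rw [hx, show (100 : ℝ) = ((100 : ℕ) : ℝ) by norm_num, rpow_natCast] at h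
  have hRn : R ≤ R * n := le_mul_of_one_le_right (by linarith) (by linarith)
  have h2n : 2 ≤ R * n := by nlinarith
  have hRn0 : 0 < R * n := by linarith
  calc 160000 * κ ^ 2 * ((t : ℝ) + 1) ^ 4 * ε₀
      ≤ 160000 * R ^ 2 * (26 * R ^ 2) ^ 4 * (1 / (R * n)) ^ 100 := by gcongr
    _ = (160000 * 26 ^ 4) * R ^ 10 * (1 / (R * n)) ^ 100 := by ring
    _ ≤ 2 ^ 90 * R ^ 10 * (1 / (R * n)) ^ 100 := by
      gcongr
      norm_num
    _ ≤ (R * n) ^ 90 * (R * n) ^ 10 * (1 / (R * n)) ^ 100 := by gcongr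
    _ = 1 := by
      rw [← pow_add, ← mul_pow, mul_one_div_cancel hRn0.ne', one_pow]

end Numerics

/-! ### Residual, decay and energy error -/

section Convergence

open Finset

variable {E : Type*} [NormedAddCommGroup E] [InnerProductSpace ℝ E]
  {B : E →ₗ[ℝ] E} {α β : ℕ → ℝ} {q p : ℕ → E} {ε₀ m Λ : ℝ} {j : ℕ} {x : ℕ → ℝ}

/-- Summation by parts in the exact recurrence. The coefficients of the `q i` are those of `T' x`,
and only one boundary term survives. -/
theorem PerturbedLanczos.map_sum_smul (h : PerturbedLanczos B α β q p (j + 1) ε₀)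
    (hx : x (j + 1) = 0) :
    B (∑ i ∈ range (j + 1), x i • p i) =
      ∑ i ∈ range (j + 1), (β (i + 1) * x (i + 1) + α i * x i + β i * x (i - 1)) • q i +
        (x j * β (j + 1)) • q (j + 1) := by
  have h1 : B (∑ i ∈ range (j + 1), x i • p i) =
      ∑ i ∈ range (j + 1), (x i * β (i + 1)) • q (i + 1) +
        ∑ i ∈ range (j + 1), (x i * α i) • q i +
        ∑ i ∈ range (j + 1), (x i * β i) • q (i - 1) := by
    rw [map_sum, ← sum_add_distrib, ← sum_add_distrib]
    refine sum_congr rfl fun i hi => ?_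
    rw [map_smul, h.recur i (mem_range.mp hi)]
    module
  have h2 : ∑ i ∈ range (j + 1), (x i * β i) • q (i - 1) =
      ∑ i ∈ range (j + 1), (x (i + 1) * β (i + 1)) • q i := by
    rw [sum_range_succ', sum_range_succ _ j, h.beta_zero, hx]
    simp
  have h3 : ∑ i ∈ range (j + 1), (β i * x (i - 1)) • q i =
      ∑ i ∈ range j, (x i * β (i + 1)) • q (i + 1) := by
    rw [sum_range_succ', h.beta_zero]
    simp [mul_comm]
  simp only [add_smul, sum_add_distrib]
  rw [h1, h2, h3, sum_range_succ (fun i => (x i * β (i + 1)) • q (i + 1)) j]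
  simp only [mul_comm]
  abel

/-- Applied with `e` the error and `s` the solution: passing from relative residual to relative
energy error costs one factor `Λ / m`. -/
theorem inner_map_self_le_of_norm_map_le {ε : ℝ} (hm : 0 < m) (hmΛ : m ≤ Λ)
    (hlow : ∀ x, m * ‖x‖ ^ 2 ≤ inner ℝ (B x) x) (hB : ∀ x, ‖B x‖ ≤ Λ * ‖x‖) (hε : 0 ≤ ε) {e s : E}
    (h : Λ / m * ‖B e‖ ≤ ε * ‖B s‖) : inner ℝ (B e) e ≤ ε ^ 2 * inner ℝ (B s) s := by
  have hΛ : 0 < Λ := hm.trans_le hmΛ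
  have h1 : m * ‖e‖ ≤ ‖B e‖ := by
    rcases (norm_nonneg e).eq_or_lt with h0 | h0
    · rw [← h0, mul_zero]; positivity
    · have h2 : m * ‖e‖ * ‖e‖ ≤ ‖B e‖ * ‖e‖ := by
        linarith [hlow e, real_inner_le_norm (B e) e]
      exact le_of_mul_le_mul_right h2 h0
  have h2 : Λ / m * ‖B e‖ ≤ ε * (Λ * ‖s‖) := h.trans (by gcongr; exact hB s)
  have h3 : ‖B e‖ ≤ ε * m * ‖s‖ := by
    rw [div_mul_eq_mul_div, div_le_iff₀ hm] at h2
    exact le_of_mul_le_mul_left (by linarith) hΛ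
  have h4 : ‖e‖ ≤ ε * ‖s‖ := le_of_mul_le_mul_left (by linarith) hm
  calc inner ℝ (B e) e ≤ ‖B e‖ * ‖e‖ := real_inner_le_norm _ _
    _ ≤ (ε * m * ‖s‖) * (ε * ‖s‖) := by gcongr
    _ = ε ^ 2 * (m * ‖s‖ ^ 2) := by ring
    _ ≤ _ := by gcongr; exact hlow s

theorem PerturbedLanczos.inner_error_le_of_residual (h : PerturbedLanczos B α β q p (j + 1) ε₀)
    (hm : 0 < m) (hmΛ : m ≤ Λ) (hlow : ∀ x, m * ‖x‖ ^ 2 ≤ inner ℝ (B x) x)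
    (hB : ∀ x, ‖B x‖ ≤ Λ * ‖x‖) {ε : ℝ} (hε : 0 ≤ ε) (hx : x (j + 1) = 0)
    (hsol : ∀ i ≤ j, β (i + 1) * x (i + 1) + α i * x i + β i * x (i - 1) =
      if i = 0 then 1 else 0)
    (hres : Λ / m * (|x j| * |β (j + 1)| * ‖q (j + 1)‖) ≤ ε * ‖q 0‖) {s : E} (hs : B s = q 0) :
    inner ℝ (B (∑ i ∈ range (j + 1), x i • p i - s)) (∑ i ∈ range (j + 1), x i • p i - s) ≤
      ε ^ 2 * inner ℝ (B s) s := by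
  refine inner_map_self_le_of_norm_map_le hm hmΛ hlow hB hε ?_
  have hres' : B (∑ i ∈ range (j + 1), x i • p i - s) = (x j * β (j + 1)) • q (j + 1) := by
    rw [map_sub, h.map_sum_smul hx, hs,
      sum_congr rfl fun i hi => by rw [hsol i (by simpa [Nat.lt_succ_iff] using hi)]]
    simp
  rwa [hres', hs, norm_smul, Real.norm_eq_abs, abs_mul]

/-- The last component of the solution of the tridiagonal system, and with it the residual, is
small once the iteration has run long enough. -/
theorem PerturbedLanczos.residual_le (h' : PerturbedLanczos B α β q p (j + 2) ε₀)
    (hsym : B.IsSymmetric) (hm : 0 < m) (hmΛ : m ≤ Λ)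
    (hlow : ∀ x, m * ‖x‖ ^ 2 ≤ inner ℝ (B x) x) (hB : ∀ x, ‖B x‖ ≤ Λ * ‖x‖) (hε0 : 0 ≤ ε₀)
    (hε : 160000 * (Λ / m) ^ 2 * ((j : ℝ) + 2) ^ 4 * ε₀ ≤ 1) {ε : ℝ} (hε' : 0 < ε) (hε1 : ε < 1)
    (hx : x (j + 1) = 0)
    (hsol : ∀ i ≤ j, β (i + 1) * x (i + 1) + α i * x i + β i * x (i - 1) =
      if i = 0 then 1 else 0)
    (ht : 24 * (√(Λ / m) * Real.log (Λ / m / ε)) ≤ (j + 1 : ℕ)) :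
    Λ / m * (|x j| * |β (j + 1)| * ‖q (j + 1)‖) ≤ ε * ‖q 0‖ := by
  have hΛ : 0 < Λ := hm.trans_le hmΛ
  have hκ : 1 ≤ Λ / m := (one_le_div hm).mpr hmΛ
  have hεj : 160000 * (Λ / m) ^ 2 * ((j + 2 : ℕ) : ℝ) ^ 4 * ε₀ ≤ 1 := by exact_mod_cast hε
  have hε₀ : ε₀ ≤ 1 / 100 := by
    have h1 : (1 : ℝ) ≤ (Λ / m) ^ 2 := one_le_pow₀ hκ
    have h2 : (1 : ℝ) ≤ ((j : ℝ) + 2) ^ 4 :=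
      one_le_pow₀ (by linarith [(Nat.cast_nonneg j : (0 : ℝ) ≤ j)])
    have h3 : (1 : ℝ) ≤ (Λ / m) ^ 2 * ((j : ℝ) + 2) ^ 4 := one_le_mul_of_one_le_of_one_le h1 h2
    nlinarith
  set ρ := 1 + 1 / (2 * √(Λ / m)) with hρ
  have hsq : √(Λ / m) ^ 2 = Λ / m := Real.sq_sqrt (by positivity)
  have hs0 : 0 < √(Λ / m) := Real.sqrt_pos.mpr (by positivity)
  have hβ (i : ℕ) (hi : i ≤ j) : |β (i + 1)| ≤ (Λ - 4 / 5 * m) / 2 :=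
    h'.abs_beta_le hsym hm hmΛ hlow hB hε0 hεj (by omega)
  have hρsq : (ρ - 1) ^ 2 = m / (4 * Λ) := by
    rw [hρ, add_sub_cancel_left, div_pow, mul_pow, hsq]
    field_simp
    norm_num
  -- The choice of `ρ` makes the perturbation `β (ρ - 1)²` at most `m / 8`, so the lower bound `9/10
  -- m` leaves more than `m / 2`.
  have hdecay : m / 2 * (ρ ^ j * |x j|) ≤ 1 := by
    refine decay_of_tridiag_solution h'.beta_zero hx
      (h'.le_tridiagForm hsym hm hmΛ hlow hB hε0 hεj (by omega)) (fun i hi => hβ i hi.le)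
      (by linarith) (by rw [hρ]; exact le_add_of_nonneg_right (by positivity)) (by positivity)
      ?_ hsol
    rw [hρsq]
    have : (Λ - 4 / 5 * m) / 2 * (m / (4 * Λ)) ≤ Λ / 2 * (m / (4 * Λ)) := by
      gcongr
      linarith
    have e : Λ / 2 * (m / (4 * Λ)) = m / 8 := by field_simp; norm_num
    linarith
  have hnum := le_pow_numIter hκ hε' hε1 ht
  rw [Nat.add_sub_cancel, ← hρ] at hnum
  have hq0 := h'.le_norm hε₀ (i := 0) (by omega)
  have hqj := h'.norm_le hε₀ (i := j + 1) (by omega)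
  have hκm : (Λ - 4 / 5 * m) / 2 = m / 2 * (Λ / m - 4 / 5) := by field_simp
  have hρ0 : 0 < ρ ^ j := by positivity
  have hfac : 0 ≤ Λ / m - 4 / 5 := by linarith
  calc Λ / m * (|x j| * |β (j + 1)| * ‖q (j + 1)‖)
      ≤ Λ / m * (|x j| * (m / 2 * (Λ / m - 4 / 5)) * (101 / 100)) := by
        gcongr
        rw [← hκm]
        exact hβ j le_rfl
    _ = (m / 2 * |x j|) * ((101 / 100) * (Λ / m * (Λ / m - 4 / 5))) := by ring
    _ ≤ (m / 2 * |x j|) * ((98 / 100) * (11 / 10 * (Λ / m * (Λ / m - 4 / 5)))) := by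
        rw [← mul_assoc (98 / 100 : ℝ)]
        gcongr
        norm_num
    _ ≤ (m / 2 * |x j|) * ((98 / 100) * (ε * ρ ^ j)) := by gcongr
    _ = (m / 2 * (ρ ^ j * |x j|)) * (ε * (98 / 100)) := by ring
    _ ≤ 1 * (ε * ‖q 0‖) := by gcongr
    _ = _ := one_mul _

end Convergence

/-! ### Singular values as bounds for the quadratic form -/

section SingularValues

variable {E : Type*} [NormedAddCommGroup E] [InnerProductSpace ℝ E] [FiniteDimensional ℝ E]

theorem LinearMap.IsSymmetric.inner_map_self_eq_sum {S : E →ₗ[ℝ] E} (hS : S.IsSymmetric) {n : ℕ}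
    (hn : Module.finrank ℝ E = n) (x : E) :
    inner ℝ (S x) x = ∑ i, hS.eigenvalues hn i * inner ℝ x (hS.eigenvectorBasis hn i) ^ 2 := by
  rw [← (hS.eigenvectorBasis hn).sum_inner_mul_inner (S x) x]
  refine Finset.sum_congr rfl fun i _ => ?_
  rw [hS x, hS.apply_eigenvectorBasis, inner_smul_right, real_inner_comm x]
  simp only [RCLike.ofReal_real_eq_id, id_eq]
  ring

theorem OrthonormalBasis.norm_sq_eq_sum {E : Type*} [NormedAddCommGroup E]
    [InnerProductSpace ℝ E] {n : ℕ} (v : OrthonormalBasis (Fin n) ℝ E) (x : E) :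
    ‖x‖ ^ 2 = ∑ i, inner ℝ x (v i) ^ 2 := by
  rw [← real_inner_self_eq_norm_sq, ← v.sum_inner_mul_inner x x]
  refine Finset.sum_congr rfl fun i _ => ?_
  rw [real_inner_comm x]
  ring

theorem LinearMap.IsSymmetric.mul_norm_sq_le_inner {S : E →ₗ[ℝ] E} (hS : S.IsSymmetric) {n : ℕ}
    (hn : Module.finrank ℝ E = n) {c : ℝ} (hc : ∀ i, c ≤ hS.eigenvalues hn i) (x : E) :
    c * ‖x‖ ^ 2 ≤ inner ℝ (S x) x := by
  rw [hS.inner_map_self_eq_sum hn, (hS.eigenvectorBasis hn).norm_sq_eq_sum, Finset.mul_sum]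
  exact Finset.sum_le_sum fun i _ => mul_le_mul_of_nonneg_right (hc i) (sq_nonneg _)

theorem LinearMap.IsSymmetric.inner_le_mul_norm_sq {S : E →ₗ[ℝ] E} (hS : S.IsSymmetric) {n : ℕ}
    (hn : Module.finrank ℝ E = n) {c : ℝ} (hc : ∀ i, hS.eigenvalues hn i ≤ c) (x : E) :
    inner ℝ (S x) x ≤ c * ‖x‖ ^ 2 := by
  rw [hS.inner_map_self_eq_sum hn, (hS.eigenvectorBasis hn).norm_sq_eq_sum, Finset.mul_sum]
  exact Finset.sum_le_sum fun i _ => mul_le_mul_of_nonneg_right (hc i) (sq_nonneg _)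

theorem LinearMap.inner_adjoint_comp_self (T : E →ₗ[ℝ] E) (x : E) :
    inner ℝ ((LinearMap.adjoint T ∘ₗ T) x) x = ‖T x‖ ^ 2 := by
  rw [LinearMap.comp_apply, LinearMap.adjoint_inner_left, real_inner_self_eq_norm_sq]

theorem LinearMap.norm_map_le_singularValues (T : E →ₗ[ℝ] E) (x : E) :
    ‖T x‖ ≤ T.singularValues 0 * ‖x‖ := by
  refine (pow_le_pow_iff_left₀ (norm_nonneg _)
    (mul_nonneg (T.singularValues_nonneg 0) (norm_nonneg _)) two_ne_zero).mp ?_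
  rw [← T.inner_adjoint_comp_self, mul_pow]
  refine T.isSymmetric_adjoint_comp_self.inner_le_mul_norm_sq rfl (fun i => ?_) x
  rw [← T.sq_singularValues_fin rfl]
  exact pow_le_pow_left₀ (T.singularValues_nonneg _) (T.singularValues_antitone (Nat.zero_le _)) 2

theorem LinearMap.singularValues_mul_norm_le (T : E →ₗ[ℝ] E) (x : E) :
    T.singularValues (Module.finrank ℝ E - 1) * ‖x‖ ≤ ‖T x‖ := by
  refine (pow_le_pow_iff_left₀
    (mul_nonneg (T.singularValues_nonneg _) (norm_nonneg _)) (norm_nonneg _) two_ne_zero).mp ?_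
  rw [← T.inner_adjoint_comp_self, mul_pow]
  refine T.isSymmetric_adjoint_comp_self.mul_norm_sq_le_inner rfl (fun i => ?_) x
  rw [← T.sq_singularValues_fin rfl]
  exact pow_le_pow_left₀ (T.singularValues_nonneg _) (T.singularValues_antitone (by omega)) 2

/-- On a unit eigenvector `‖T v‖` is the absolute value of the eigenvalue, which positivity
identifies with the eigenvalue itself. -/
theorem LinearMap.IsSymmetric.singularValues_mul_norm_sq_le {T : E →ₗ[ℝ] E} (hT : T.IsSymmetric)
    (hpos : ∀ x, 0 ≤ inner ℝ (T x) x) (x : E) :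
    T.singularValues (Module.finrank ℝ E - 1) * ‖x‖ ^ 2 ≤ inner ℝ (T x) x := by
  refine hT.mul_norm_sq_le_inner rfl (fun i => ?_) x
  have h1 := T.singularValues_mul_norm_le (hT.eigenvectorBasis rfl i)
  have h2 := hpos (hT.eigenvectorBasis rfl i)
  rw [hT.apply_eigenvectorBasis] at h1 h2
  rw [norm_smul, (hT.eigenvectorBasis rfl).norm_eq_one, mul_one, mul_one] at h1
  rw [inner_smul_left, real_inner_self_eq_norm_sq, (hT.eigenvectorBasis rfl).norm_eq_one] at h2
  simp only [RCLike.ofReal_real_eq_id, id_eq, conj_trivial, one_pow, mul_one,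
    Real.norm_eq_abs] at h1 h2
  rwa [abs_of_nonneg h2] at h1

theorem LinearMap.singularValues_pos_of_inner_pos [Nontrivial E] {T : E →ₗ[ℝ] E}
    (hpos : ∀ x, x ≠ 0 → 0 < inner ℝ (T x) x) :
    0 < T.singularValues (Module.finrank ℝ E - 1) := by
  refine T.injective_iff_forall_lt_finrank_singularValues_pos.mp ?_ _
    (Nat.sub_lt Module.finrank_pos one_pos)
  rw [injective_iff_map_eq_zero]
  intro x hx
  by_contra h
  have := hpos x h
  simp [hx] at this

end SingularValues

/-! ### Change of coordinates by the square root of the preconditioner -/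

section Scaling

open WithLp

variable {n : ℕ} {M : Matrix (Fin n) (Fin n) ℝ}

theorem sqrt_mul_sqrt (hM : M.PosDef) : CFC.sqrt M * CFC.sqrt M = M :=
  CFC.sqrt_mul_sqrt_self M hM.posSemidef.nonneg

theorem isUnit_det_sqrt (hM : M.PosDef) : IsUnit (CFC.sqrt M).det := by
  have h := hM.isUnit
  rw [Matrix.isUnit_iff_isUnit_det, ← sqrt_mul_sqrt hM, Matrix.det_mul] at h
  exact isUnit_of_mul_isUnit_left h

theorem transpose_sqrt (M : Matrix (Fin n) (Fin n) ℝ) : (CFC.sqrt M)ᵀ = CFC.sqrt M := by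
  have := (Matrix.nonneg_iff_posSemidef.mp (CFC.sqrt_nonneg M)).isHermitian
  rwa [Matrix.IsHermitian, Matrix.conjTranspose_eq_transpose_of_trivial] at this

/-- Lower vectors are scaled by `M^{-1/2}` and upper ones by `M^{1/2}`, so the dot products the
algorithm computes become inner products. -/
theorem inner_toLp_inv_sqrt_mulVec (hM : M.PosDef) (x y : Fin n → ℝ) :
    inner ℝ (toLp 2 ((CFC.sqrt M)⁻¹ *ᵥ x)) (toLp 2 (CFC.sqrt M *ᵥ y)) = x ⬝ᵥ y := by
  rw [EuclideanSpace.inner_toLp_toLp, star_trivial, dotProduct_comm, Matrix.dotProduct_mulVec,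
    ← Matrix.mulVec_transpose, transpose_sqrt, Matrix.mulVec_mulVec,
    Matrix.mul_nonsing_inv _ (isUnit_det_sqrt hM), Matrix.one_mulVec]

theorem matNorm_eq_norm (hM : M.PosDef) (x : Fin n → ℝ) :
    PrecondLanczos.matNorm M x = ‖toLp 2 (CFC.sqrt M *ᵥ x)‖ := by
  have h : x ⬝ᵥ M *ᵥ x = ‖toLp 2 (CFC.sqrt M *ᵥ x)‖ ^ 2 := by
    rw [← real_inner_self_eq_norm_sq, EuclideanSpace.inner_toLp_toLp, star_trivial,
      Matrix.dotProduct_mulVec (CFC.sqrt M *ᵥ x), ← Matrix.mulVec_transpose, transpose_sqrt,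
      Matrix.mulVec_mulVec, sqrt_mul_sqrt hM, dotProduct_comm]
  rw [PrecondLanczos.matNorm, h, Real.sqrt_sq (norm_nonneg _)]

theorem sqrt_mulVec_inv_mulVec (hM : M.PosDef) (x : Fin n → ℝ) :
    CFC.sqrt M *ᵥ (M⁻¹ *ᵥ x) = (CFC.sqrt M)⁻¹ *ᵥ x := by
  have h : M⁻¹ = (CFC.sqrt M)⁻¹ * (CFC.sqrt M)⁻¹ := by
    rw [← Matrix.mul_inv_rev, sqrt_mul_sqrt hM]
  rw [Matrix.mulVec_mulVec, h, Matrix.mul_nonsing_inv_cancel_left _ _ (isUnit_det_sqrt hM)]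

/-- The operator of the preconditioned matrix. -/
noncomputable def precondOp (A M : Matrix (Fin n) (Fin n) ℝ) :
    EuclideanSpace ℝ (Fin n) →ₗ[ℝ] EuclideanSpace ℝ (Fin n) :=
  Matrix.toEuclideanLin ((CFC.sqrt M)⁻¹ * A * (CFC.sqrt M)⁻¹)

variable {A : Matrix (Fin n) (Fin n) ℝ}

theorem precondOp_sqrt_mulVec (hM : M.PosDef) (x : Fin n → ℝ) :
    precondOp A M (toLp 2 (CFC.sqrt M *ᵥ x)) = toLp 2 ((CFC.sqrt M)⁻¹ *ᵥ (A *ᵥ x)) := by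
  rw [precondOp, Matrix.toLpLin_toLp, Matrix.toLin'_apply, Matrix.mulVec_mulVec, Matrix.mul_assoc,
    Matrix.nonsing_inv_mul _ (isUnit_det_sqrt hM), Matrix.mul_one, Matrix.mulVec_mulVec]

theorem inner_precondOp_sqrt_mulVec (hM : M.PosDef) (x : Fin n → ℝ) :
    inner ℝ (precondOp A M (toLp 2 (CFC.sqrt M *ᵥ x))) (toLp 2 (CFC.sqrt M *ᵥ x)) =
      x ⬝ᵥ A *ᵥ x := by
  rw [precondOp_sqrt_mulVec hM, inner_toLp_inv_sqrt_mulVec hM, dotProduct_comm]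

theorem exists_eq_toLp_sqrt_mulVec (hM : M.PosDef) (x : EuclideanSpace ℝ (Fin n)) :
    ∃ y : Fin n → ℝ, x = toLp 2 (CFC.sqrt M *ᵥ y) :=
  ⟨(CFC.sqrt M)⁻¹ *ᵥ ofLp x, by
    rw [Matrix.mulVec_mulVec, Matrix.mul_nonsing_inv _ (isUnit_det_sqrt hM), Matrix.one_mulVec,
      toLp_ofLp]⟩

theorem inner_precondOp_pos (hA : A.PosDef) (hM : M.PosDef) {x : EuclideanSpace ℝ (Fin n)}
    (hx : x ≠ 0) : 0 < inner ℝ (precondOp A M x) x := by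
  obtain ⟨y, rfl⟩ := exists_eq_toLp_sqrt_mulVec hM x
  rw [inner_precondOp_sqrt_mulVec hM]
  have hy : y ≠ 0 := by
    rintro rfl
    simp at hx
  simpa using hA.dotProduct_mulVec_pos hy

theorem precondOp_isSymmetric (hA : A.PosDef) : (precondOp A M).IsSymmetric := by
  rw [precondOp, Matrix.isSymmetric_toEuclideanLin_iff]
  have hA' : Aᵀ = A := by
    have := hA.isHermitian
    rwa [Matrix.IsHermitian, Matrix.conjTranspose_eq_transpose_of_trivial] at this
  rw [Matrix.IsHermitian, Matrix.conjTranspose_eq_transpose_of_trivial, Matrix.transpose_mul,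
    Matrix.transpose_mul, Matrix.transpose_nonsing_inv, transpose_sqrt, hA', Matrix.mul_assoc]

end Scaling

/-! ### The algorithm as a perturbed Lanczos recurrence -/

namespace PrecondLanczos

open WithLp

section Run

variable {n : ℕ} {A M : Matrix (Fin n) (Fin n) ℝ} {b : Fin n → ℝ}
  {SolveM : (Fin n → ℝ) → (Fin n → ℝ)} {ε₀ : ℝ}

theorem norm_solve_sub_le (hM : M.PosDef)
    (hs : ∀ r, matNorm M (SolveM r - M⁻¹ *ᵥ r) ≤ ε₀ * matNorm M (M⁻¹ *ᵥ r)) (c : ℝ)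
    (r : Fin n → ℝ) :
    ‖toLp 2 (CFC.sqrt M *ᵥ (c • SolveM r)) - toLp 2 ((CFC.sqrt M)⁻¹ *ᵥ (c • r))‖ ≤
      ε₀ * ‖toLp 2 ((CFC.sqrt M)⁻¹ *ᵥ (c • r))‖ := by
  have h := hs r
  rw [matNorm_eq_norm hM, matNorm_eq_norm hM, Matrix.mulVec_sub, sqrt_mulVec_inv_mulVec hM,
    toLp_sub] at h
  rw [Matrix.mulVec_smul, Matrix.mulVec_smul, toLp_smul, toLp_smul, ← smul_sub, norm_smul,
    norm_smul]
  nlinarith [mul_le_mul_of_nonneg_left h (norm_nonneg c)]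

theorem toLp_inv_sqrt_mulVec_ne_zero (hM : M.PosDef) {r : Fin n → ℝ} (hr : r ≠ 0) :
    toLp 2 ((CFC.sqrt M)⁻¹ *ᵥ r) ≠ 0 := by
  intro h
  apply hr
  have h1 : (CFC.sqrt M)⁻¹ *ᵥ r = 0 := by simpa using h
  rw [← Matrix.one_mulVec r, ← Matrix.mul_nonsing_inv _ (isUnit_det_sqrt hM),
    ← Matrix.mulVec_mulVec, h1, Matrix.mulVec_zero]

theorem precision_nonneg (hM : M.PosDef)
    (hs : ∀ r, matNorm M (SolveM r - M⁻¹ *ᵥ r) ≤ ε₀ * matNorm M (M⁻¹ *ᵥ r)) (hb : b ≠ 0) :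
    0 ≤ ε₀ := by
  have h := norm_solve_sub_le hM hs 1 b
  rw [one_smul, one_smul] at h
  exact nonneg_of_mul_nonneg_left ((norm_nonneg _).trans h)
    (norm_pos_iff.mpr (toLp_inv_sqrt_mulVec_ne_zero hM hb))

theorem dotProduct_solve_pos (hM : M.PosDef)
    (hs : ∀ r, matNorm M (SolveM r - M⁻¹ *ᵥ r) ≤ ε₀ * matNorm M (M⁻¹ *ᵥ r)) (hε : ε₀ < 1)
    {r : Fin n → ℝ} (hr : r ≠ 0) : 0 < r ⬝ᵥ SolveM r := by
  have h := norm_solve_sub_le hM hs 1 r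
  rw [one_smul, one_smul] at h
  rw [← inner_toLp_inv_sqrt_mulVec hM]
  have hy := norm_pos_iff.mpr (toLp_inv_sqrt_mulVec_ne_zero hM hr)
  set y := toLp 2 ((CFC.sqrt M)⁻¹ *ᵥ r)
  set z := toLp 2 (CFC.sqrt M *ᵥ SolveM r)
  have h1 : inner ℝ y z = ‖y‖ ^ 2 + inner ℝ y (z - y) := by
    rw [inner_sub_right, real_inner_self_eq_norm_sq]; ring
  have h2 := (abs_le.mp (abs_real_inner_le_norm y (z - y))).1
  have h3 : ‖y‖ * ‖z - y‖ ≤ ‖y‖ * (ε₀ * ‖y‖) := by gcongr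
  have h4 : 0 < (1 - ε₀) * ‖y‖ ^ 2 := mul_pos (by linarith) (by positivity)
  rw [h1]
  linarith

theorem inv_sqrt_smul_dotProduct {r s : Fin n → ℝ} (h : √(r ⬝ᵥ s) ≠ 0) :
    ((√(r ⬝ᵥ s))⁻¹ • r) ⬝ᵥ ((√(r ⬝ᵥ s))⁻¹ • s) = 1 := by
  have h0 : 0 ≤ r ⬝ᵥ s := by
    by_contra hc
    exact h (Real.sqrt_eq_zero_of_nonpos (not_le.mp hc).le)
  rw [smul_dotProduct, dotProduct_smul, smul_eq_mul, smul_eq_mul]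
  nth_rewrite 3 [← Real.mul_self_sqrt h0]
  field_simp

variable (A M b SolveM) in
/-- The vectors `M^{-1/2} q̲ᵢ₊₁`. -/
noncomputable def lowVec (i : ℕ) : EuclideanSpace ℝ (Fin n) :=
  toLp 2 ((CFC.sqrt M)⁻¹ *ᵥ (stateAt A b SolveM i).qLow)

variable (A M b SolveM) in
/-- The vectors `M^{1/2} q̅ᵢ₊₁`. -/
noncomputable def upVec (i : ℕ) : EuclideanSpace ℝ (Fin n) :=
  toLp 2 (CFC.sqrt M *ᵥ (stateAt A b SolveM i).qUp)

/-- This also holds at breakdown: for `ε₀ < 1` the pairing of `w ≠ 0` with `SolveM w` is positive,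
so `β = 0` forces `w = 0`. -/
theorem beta_smul_qLow_succ (hM : M.PosDef)
    (hs : ∀ r, matNorm M (SolveM r - M⁻¹ *ᵥ r) ≤ ε₀ * matNorm M (M⁻¹ *ᵥ r)) (hε : ε₀ < 1) (i : ℕ) :
    (stateAt A b SolveM (i + 1)).beta • (stateAt A b SolveM (i + 1)).qLow =
      wLow A (stateAt A b SolveM i) := by
  set s := stateAt A b SolveM i with hsdef
  change betaNext A SolveM s • ((betaNext A SolveM s)⁻¹ • wLow A s) = wLow A s
  by_cases h : betaNext A SolveM s = 0
  · have hw : wLow A s = 0 := by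
      by_contra hw
      exact (Real.sqrt_pos.mpr (dotProduct_solve_pos hM hs hε hw)).ne' h
    rw [hw, smul_zero, smul_zero]
  · exact smul_inv_smul₀ h _

theorem beta_smul_qPrev (i : ℕ) :
    (stateAt A b SolveM i).beta • (stateAt A b SolveM i).qPrev =
      (stateAt A b SolveM i).beta • (stateAt A b SolveM (i - 1)).qLow := by
  rcases i with _ | i
  · simp [stateAt, init]
  · rfl

theorem qLow_dotProduct_qUp (hz : zInit b SolveM ≠ 0) {i : ℕ}
    (h : i = 0 ∨ (stateAt A b SolveM i).beta ≠ 0) :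
    (stateAt A b SolveM i).qLow ⬝ᵥ (stateAt A b SolveM i).qUp = 1 := by
  rcases i with _ | i
  · exact inv_sqrt_smul_dotProduct hz
  · exact inv_sqrt_smul_dotProduct (h.resolve_left (Nat.succ_ne_zero i))

theorem zInit_pos (hM : M.PosDef)
    (hs : ∀ r, matNorm M (SolveM r - M⁻¹ *ᵥ r) ≤ ε₀ * matNorm M (M⁻¹ *ᵥ r)) (hε : ε₀ < 1)
    (hb : b ≠ 0) : 0 < zInit b SolveM :=
  Real.sqrt_pos.mpr (dotProduct_solve_pos hM hs hε hb)

theorem perturbedLanczos (hM : M.PosDef)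
    (hs : ∀ r, matNorm M (SolveM r - M⁻¹ *ᵥ r) ≤ ε₀ * matNorm M (M⁻¹ *ᵥ r)) (hε : ε₀ < 1)
    (hb : b ≠ 0) {k : ℕ} (hk : ∀ i, 1 ≤ i → i < k → (stateAt A b SolveM i).beta ≠ 0) :
    PerturbedLanczos (precondOp A M) (fun i => alpha A (stateAt A b SolveM i))
      (fun i => (stateAt A b SolveM i).beta) (lowVec A M b SolveM) (upVec A M b SolveM) k ε₀ := by
  have hz := (zInit_pos hM hs hε hb).ne'
  have hunit {i : ℕ} (hi : i < k) :
      (stateAt A b SolveM i).qLow ⬝ᵥ (stateAt A b SolveM i).qUp = 1 := by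
    refine qLow_dotProduct_qUp hz ?_
    rcases Nat.eq_zero_or_pos i with h | h
    · exact Or.inl h
    · exact Or.inr (hk i h hi)
  constructor
  · rfl
  · intro i _
    have h1 : A *ᵥ (stateAt A b SolveM i).qUp =
        (stateAt A b SolveM (i + 1)).beta • (stateAt A b SolveM (i + 1)).qLow +
          alpha A (stateAt A b SolveM i) • (stateAt A b SolveM i).qLow +
          (stateAt A b SolveM i).beta • (stateAt A b SolveM (i - 1)).qLow := by
      rw [beta_smul_qLow_succ hM hs hε, ← beta_smul_qPrev, wLow, uLow]
      abel
    rw [upVec, precondOp_sqrt_mulVec hM, h1]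
    simp only [Matrix.mulVec_add, Matrix.mulVec_smul, toLp_add, toLp_smul, lowVec]
  · intro i _
    rcases i with _ | i
    · exact norm_solve_sub_le hM hs _ b
    · exact norm_solve_sub_le hM hs _ (wLow A (stateAt A b SolveM i))
  · intro i hi
    rw [lowVec, upVec, inner_toLp_inv_sqrt_mulVec hM]
    exact hunit hi
  · intro i hi
    rw [lowVec, upVec, inner_toLp_inv_sqrt_mulVec hM, ← smul_eq_mul, ← smul_dotProduct,
      beta_smul_qLow_succ hM hs hε, wLow, sub_dotProduct, smul_dotProduct, hunit hi, smul_eq_mul,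
      mul_one, alpha, sub_self]

theorem numIter_mem (t : ℕ) : numIter A b SolveM t = t ∨
    (1 ≤ numIter A b SolveM t ∧ numIter A b SolveM t ≤ t ∧
      (stateAt A b SolveM (numIter A b SolveM t)).beta = 0) :=
  Nat.sInf_mem (s := {k : ℕ | k = t ∨ (1 ≤ k ∧ k ≤ t ∧ (stateAt A b SolveM k).beta = 0)})
    ⟨t, Or.inl rfl⟩

theorem beta_ne_zero_of_lt_numIter {t i : ℕ} (hi : 1 ≤ i) (h : i < numIter A b SolveM t) :
    (stateAt A b SolveM i).beta ≠ 0 := by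
  intro h0
  have hle : numIter A b SolveM t ≤ t := Nat.sInf_le (Or.inl rfl)
  exact Nat.notMem_of_lt_sInf h (Or.inr ⟨hi, h.le.trans hle, h0⟩)

/-- Extension of a vector by zero to a sequence. -/
def extend {k : ℕ} (x : Fin k → ℝ) (i : ℕ) : ℝ := if h : i < k then x ⟨i, h⟩ else 0

@[simp]
theorem extend_fin {k : ℕ} (x : Fin k → ℝ) (i : Fin k) : extend x i = x i := by
  simp [extend]

theorem extend_of_le {k : ℕ} (x : Fin k → ℝ) {i : ℕ} (h : k ≤ i) : extend x i = 0 := by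
  simp [extend, h]

/-- Extension by zero handles the last row. In row `0` the truncated index `i - 1` is harmless
because the initial `beta` is zero. -/
theorem tridiag_mulVec {k : ℕ} (x : Fin k → ℝ) (i : Fin k) :
    (tridiag A b SolveM k *ᵥ x) i =
      (stateAt A b SolveM (i + 1)).beta * extend x (i + 1) +
        alpha A (stateAt A b SolveM i) * extend x i +
        (stateAt A b SolveM i).beta * extend x (i - 1) := by
  set F : ℕ → ℝ := fun j =>
    (if j = i + 1 then (stateAt A b SolveM (i + 1)).beta * extend x (i + 1) else 0) +
      (if j = i then alpha A (stateAt A b SolveM i) * extend x i else 0) +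
      (if j + 1 = i then (stateAt A b SolveM i).beta * extend x (i - 1) else 0) with hF
  have h1 : (tridiag A b SolveM k *ᵥ x) i = ∑ j : Fin k, F j := by
    rw [Matrix.mulVec, dotProduct]
    refine Finset.sum_congr rfl fun j _ => ?_
    simp only [tridiag, Matrix.of_apply, hF, Fin.ext_iff]
    by_cases e1 : (i : ℕ) = j
    · obtain rfl : i = j := Fin.ext e1
      simp
    by_cases e2 : (j : ℕ) = i + 1
    · have e3 : ¬ (j : ℕ) = i := by omega
      have e4 : ¬ (j : ℕ) + 1 = i := by omega
      rw [if_neg e1, if_pos e2, if_pos e2, if_neg e3, if_neg e4, ← e2, extend_fin]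
      ring
    by_cases e3 : (i : ℕ) = j + 1
    · have e4 : ¬ (j : ℕ) = i := by omega
      have e5 : (i : ℕ) - 1 = j := by omega
      rw [if_neg e1, if_neg e2, if_pos e3, if_neg e2, if_neg e4, if_pos e3.symm, e5, extend_fin]
      ring
    · have e4 : ¬ (j : ℕ) = i := by omega
      have e5 : ¬ (j : ℕ) + 1 = i := by omega
      simp [e1, e2, e3, e4, e5]
  rw [h1, Fin.sum_univ_eq_sum_range F k]
  simp only [hF, Finset.sum_add_distrib]
  congr 1
  · congr 1
    · simp only [Finset.sum_ite_eq', Finset.mem_range]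
      split_ifs with h
      · rfl
      · rw [extend_of_le x (not_lt.mp h), mul_zero]
    · simp only [Finset.sum_ite_eq', Finset.mem_range, if_pos i.2]
  · rcases hi : (i : ℕ) with _ | i'
    · simp [stateAt, init]
    · simp only [Nat.add_right_cancel_iff, Nat.add_sub_cancel]
      simp only [Finset.sum_ite_eq', Finset.mem_range, if_pos (by omega : i' < k)]

/-- The weighted identity at `ρ = 1` is the plain quadratic form, so coercivity kills the kernel. -/
theorem isUnit_tridiag {j : ℕ} {c : ℝ} (hc : 0 < c)
    (hform : ∀ x, c * ∑ i ∈ Finset.range (j + 1), x i ^ 2 ≤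
      tridiagForm (fun i => alpha A (stateAt A b SolveM i))
        (fun i => (stateAt A b SolveM i).beta) j x) :
    IsUnit (tridiag A b SolveM (j + 1)) := by
  rw [← Matrix.mulVec_injective_iff_isUnit, ← Matrix.coe_mulVecLin, injective_iff_map_eq_zero]
  intro x hx
  rw [Matrix.mulVecLin_apply] at hx
  have h1 := sum_weighted_tridiag (a := fun i => alpha A (stateAt A b SolveM i))
    (b := fun i => (stateAt A b SolveM i).beta) (x := extend x) (j := j) rfl
    (extend_of_le x le_rfl) 1
  have h2 : ∀ i ∈ Finset.range (j + 1), (1 : ℝ) ^ (2 * i) * extend x i *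
      ((stateAt A b SolveM (i + 1)).beta * extend x (i + 1) +
        alpha A (stateAt A b SolveM i) * extend x i +
        (stateAt A b SolveM i).beta * extend x (i - 1)) = 0 := by
    intro i hi
    have := tridiag_mulVec (A := A) (b := b) (SolveM := SolveM) x ⟨i, Finset.mem_range.mp hi⟩
    rw [hx] at this
    rw [← this]
    simp
  rw [Finset.sum_eq_zero h2] at h1
  simp only [one_pow, one_mul, sub_self, ne_eq, OfNat.ofNat_ne_zero, not_false_eq_true, zero_pow,
    zero_mul, add_zero] at h1
  have h3 := hform (extend x)
  have h4 : ∑ i ∈ Finset.range (j + 1), extend x i ^ 2 = 0 := by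
    refine le_antisymm ?_ (Finset.sum_nonneg fun i _ => sq_nonneg _)
    by_contra hne
    have := mul_pos hc (not_le.mp hne)
    linarith
  rw [Finset.sum_eq_zero_iff_of_nonneg fun i _ => sq_nonneg _] at h4
  ext i
  have := h4 i (Finset.mem_range.mpr i.2)
  simpa using this

variable (A b SolveM) in
/-- The coefficient vector `T'⁻¹ e₁`, extended by zero. -/
noncomputable def coeff (k : ℕ) : ℕ → ℝ := extend ((tridiag A b SolveM k)⁻¹ *ᵥ firstVec k)

theorem coeff_recurrence {k : ℕ} (hT : IsUnit (tridiag A b SolveM k)) {i : ℕ} (hi : i < k) :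
    (stateAt A b SolveM (i + 1)).beta * coeff A b SolveM k (i + 1) +
        alpha A (stateAt A b SolveM i) * coeff A b SolveM k i +
        (stateAt A b SolveM i).beta * coeff A b SolveM k (i - 1) = if i = 0 then 1 else 0 := by
  have h := tridiag_mulVec (A := A) (b := b) (SolveM := SolveM)
    ((tridiag A b SolveM k)⁻¹ *ᵥ firstVec k) ⟨i, hi⟩
  rw [Matrix.mulVec_mulVec,
    Matrix.mul_nonsing_inv _ ((Matrix.isUnit_iff_isUnit_det _).mp hT), Matrix.one_mulVec] at h
  exact h.symm

theorem sqrt_mulVec_basisMatrix (k : ℕ) :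
    toLp 2 (CFC.sqrt M *ᵥ (basisMatrix A b SolveM k *ᵥ
      ((tridiag A b SolveM k)⁻¹ *ᵥ firstVec k))) =
      ∑ i ∈ Finset.range k, coeff A b SolveM k i • upVec A M b SolveM i := by
  have h : basisMatrix A b SolveM k *ᵥ ((tridiag A b SolveM k)⁻¹ *ᵥ firstVec k) =
      ∑ i ∈ Finset.range k, coeff A b SolveM k i • (stateAt A b SolveM i).qUp := by
    rw [← Fin.sum_univ_eq_sum_range
      (fun i => coeff A b SolveM k i • (stateAt A b SolveM i).qUp) k]
    ext r
    simp [Matrix.mulVec, dotProduct, basisMatrix, coeff, mul_comm]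
  rw [h, ← Matrix.toLin'_apply, map_sum, toLp_sum]
  refine Finset.sum_congr rfl fun i _ => ?_
  rw [map_smul, toLp_smul, upVec, Matrix.toLin'_apply]

/-- Transfer of an energy norm bound from the scaled quantities to the original ones. -/
theorem matNorm_output_sub_le (hA : A.PosDef) (hM : M.PosDef) (hz : zInit b SolveM ≠ 0) {ε : ℝ}
    (hε : 0 ≤ ε) (k : ℕ)
    (h : ∀ s, precondOp A M s = lowVec A M b SolveM 0 →
      inner ℝ (precondOp A M
          (∑ i ∈ Finset.range k, coeff A b SolveM k i • upVec A M b SolveM i - s))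
        (∑ i ∈ Finset.range k, coeff A b SolveM k i • upVec A M b SolveM i - s) ≤
        ε ^ 2 * inner ℝ (precondOp A M s) s) :
    matNorm A (zInit b SolveM • (basisMatrix A b SolveM k *ᵥ
        ((tridiag A b SolveM k)⁻¹ *ᵥ firstVec k)) - A⁻¹ *ᵥ b) ≤ ε * matNorm A (A⁻¹ *ᵥ b) := by
  set z := zInit b SolveM with hzdef
  have hAinv : A *ᵥ (A⁻¹ *ᵥ b) = b := by
    rw [Matrix.mulVec_mulVec, Matrix.mul_nonsing_inv _
      ((Matrix.isUnit_iff_isUnit_det _).mp hA.isUnit), Matrix.one_mulVec]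
  set s := toLp 2 (CFC.sqrt M *ᵥ (z⁻¹ • (A⁻¹ *ᵥ b))) with hs
  have hBs : precondOp A M s = lowVec A M b SolveM 0 := by
    rw [hs, precondOp_sqrt_mulVec hM, Matrix.mulVec_smul, hAinv]
    rfl
  have h1 := h s hBs
  rw [← sqrt_mulVec_basisMatrix, hs, ← toLp_sub, ← Matrix.mulVec_sub,
    inner_precondOp_sqrt_mulVec hM, inner_precondOp_sqrt_mulVec hM] at h1
  set v := basisMatrix A b SolveM k *ᵥ ((tridiag A b SolveM k)⁻¹ *ᵥ firstVec k)
  have hscale (y : Fin n → ℝ) : (z • y) ⬝ᵥ A *ᵥ (z • y) = z ^ 2 * (y ⬝ᵥ A *ᵥ y) := by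
    rw [Matrix.mulVec_smul, smul_dotProduct, dotProduct_smul, smul_eq_mul, smul_eq_mul]
    ring
  have e1 : z • v - A⁻¹ *ᵥ b = z • (v - z⁻¹ • (A⁻¹ *ᵥ b)) := by
    rw [smul_sub, smul_inv_smul₀ hz]
  have e2 : A⁻¹ *ᵥ b = z • (z⁻¹ • (A⁻¹ *ᵥ b)) := (smul_inv_smul₀ hz _).symm
  have h2 : (z • v - A⁻¹ *ᵥ b) ⬝ᵥ A *ᵥ (z • v - A⁻¹ *ᵥ b) ≤
      ε ^ 2 * ((A⁻¹ *ᵥ b) ⬝ᵥ A *ᵥ (A⁻¹ *ᵥ b)) := by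
    calc _ = z ^ 2 * ((v - z⁻¹ • (A⁻¹ *ᵥ b)) ⬝ᵥ A *ᵥ (v - z⁻¹ • (A⁻¹ *ᵥ b))) := by
          rw [e1, hscale]
      _ ≤ z ^ 2 * (ε ^ 2 * ((z⁻¹ • (A⁻¹ *ᵥ b)) ⬝ᵥ A *ᵥ (z⁻¹ • (A⁻¹ *ᵥ b)))) := by gcongr
      _ = ε ^ 2 * ((z • (z⁻¹ • (A⁻¹ *ᵥ b))) ⬝ᵥ A *ᵥ (z • (z⁻¹ • (A⁻¹ *ᵥ b)))) := by
          rw [hscale]; ring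
      _ = _ := by rw [smul_inv_smul₀ hz]
  rw [matNorm, matNorm]
  calc _ ≤ √(ε ^ 2 * ((A⁻¹ *ᵥ b) ⬝ᵥ A *ᵥ (A⁻¹ *ᵥ b))) := Real.sqrt_le_sqrt h2
    _ = _ := by rw [Real.sqrt_mul (sq_nonneg ε), Real.sqrt_sq hε]

end Run

end PrecondLanczos

/-! ### Assembly of the theorem -/

namespace PrecondLanczos

section Main

variable {n : ℕ} {A M : Matrix (Fin n) (Fin n) ℝ} {b : Fin n → ℝ}
  {SolveM : (Fin n → ℝ) → (Fin n → ℝ)} {ε₀ : ℝ}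

theorem output_zero (t : ℕ) : output A 0 SolveM t = 0 := by
  rw [output, zInit, zero_dotProduct, Real.sqrt_zero, zero_smul]

theorem matNorm_zero : matNorm A 0 = 0 := by
  simp [matNorm]

theorem spectral_bounds (hn : 0 < n) (hA : A.PosDef) (hM : M.PosDef) :
    0 < (precondOp A M).singularValues (n - 1) ∧
      (precondOp A M).singularValues (n - 1) ≤ (precondOp A M).singularValues 0 ∧
      (∀ x, (precondOp A M).singularValues (n - 1) * ‖x‖ ^ 2 ≤ inner ℝ (precondOp A M x) x) ∧
      ∀ x, ‖precondOp A M x‖ ≤ (precondOp A M).singularValues 0 * ‖x‖ := by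
  have hfin : Module.finrank ℝ (EuclideanSpace ℝ (Fin n)) = n := finrank_euclideanSpace_fin
  have : Nontrivial (EuclideanSpace ℝ (Fin n)) :=
    Module.nontrivial_of_finrank_pos (R := ℝ) (by rwa [hfin])
  have h1 := LinearMap.singularValues_pos_of_inner_pos
    (T := precondOp A M) fun x hx => inner_precondOp_pos hA hM hx
  have h2 := (precondOp_isSymmetric (M := M) hA).singularValues_mul_norm_sq_le fun x => by
    by_cases hx : x = 0
    · simp [hx]
    · exact (inner_precondOp_pos hA hM hx).le
  rw [hfin] at h1 h2
  exact ⟨h1, LinearMap.singularValues_antitone _ (Nat.zero_le _), h2,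
    LinearMap.norm_map_le_singularValues _⟩

theorem one_le_precondNumber (hn : 0 < n) (hA : A.PosDef) (hM : M.PosDef) :
    1 ≤ precondNumber A M := by
  obtain ⟨h1, h2, -, -⟩ := spectral_bounds hn hA hM
  exact (one_le_div h1).mpr h2

theorem alpha_zero_pos (hA : A.PosDef)
    (hunit : (stateAt A b SolveM 0).qLow ⬝ᵥ (stateAt A b SolveM 0).qUp = 1) :
    0 < alpha A (stateAt A b SolveM 0) := by
  have hne : (stateAt A b SolveM 0).qUp ≠ 0 := by
    intro h
    simp [h] at hunit
  have h := hA.dotProduct_mulVec_pos hne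
  rw [star_trivial, dotProduct_comm] at h
  have hu : uLow A (stateAt A b SolveM 0) = A *ᵥ (stateAt A b SolveM 0).qUp := by
    simp [uLow, stateAt, init]
  rwa [alpha, hu]

/-- In dimension one the iteration breaks down after the first step. -/
theorem beta_one_eq_zero {A M : Matrix (Fin 1) (Fin 1) ℝ} {b : Fin 1 → ℝ}
    {SolveM : (Fin 1 → ℝ) → (Fin 1 → ℝ)} (hM : M.PosDef)
    (hs : ∀ r, matNorm M (SolveM r - M⁻¹ *ᵥ r) ≤ ε₀ * matNorm M (M⁻¹ *ᵥ r)) (hε : ε₀ < 1)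
    (hb : b ≠ 0) : (stateAt A b SolveM 1).beta = 0 := by
  by_contra h
  have hz := (zInit_pos hM hs hε hb).ne'
  have hPL := perturbedLanczos (A := A) hM hs hε hb (k := 1) (fun i h1 h2 => by omega)
  have h1 := (mul_eq_zero.mp (hPL.orth 0 one_pos)).resolve_left h
  rw [lowVec, upVec, inner_toLp_inv_sqrt_mulVec hM] at h1
  have h2 := qLow_dotProduct_qUp (A := A) hz (i := 0) (Or.inl rfl)
  have h3 := qLow_dotProduct_qUp (A := A) hz (i := 1) (Or.inr h)
  simp only [dotProduct, Finset.univ_unique, Fin.default_eq_zero, Finset.sum_singleton] at h1 h2 h3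
  rcases mul_eq_zero.mp h1 with h4 | h4
  · rw [h4, zero_mul] at h3
    exact zero_ne_one h3
  · rw [h4, mul_zero] at h2
    exact zero_ne_one h2

/-- If the final `β` is zero the residual vanishes exactly. Otherwise all `t` iterations ran and
decay applies. Dimension one always falls into the first case after one iteration, so the precision
bound is needed only for `n ≠ 1`. -/
theorem solve_of_breakdown_or_long (hn : 0 < n) (hA : A.PosDef) (hM : M.PosDef) (hb : b ≠ 0)
    (hs : ∀ r, matNorm M (SolveM r - M⁻¹ *ᵥ r) ≤ ε₀ * matNorm M (M⁻¹ *ᵥ r)) (hε₀ : ε₀ < 1)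
    {ε : ℝ} (hε : 0 < ε) (hε1 : ε < 1) {t k : ℕ} (hk : 1 ≤ k) (hkt : k ≤ t)
    (hβ : ∀ i, 1 ≤ i → i < k → (stateAt A b SolveM i).beta ≠ 0)
    (hfin : k = t ∨ (stateAt A b SolveM k).beta = 0)
    (ht : 24 * (√(precondNumber A M) * Real.log (precondNumber A M / ε)) ≤ t)
    (hprec : n = 1 ∨ 160000 * precondNumber A M ^ 2 * ((t : ℝ) + 1) ^ 4 * ε₀ ≤ 1) :
    IsUnit (tridiag A b SolveM k) ∧
      matNorm A (zInit b SolveM • (basisMatrix A b SolveM k *ᵥ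
        ((tridiag A b SolveM k)⁻¹ *ᵥ firstVec k)) - A⁻¹ *ᵥ b) ≤ ε * matNorm A (A⁻¹ *ᵥ b) := by
  have hz := (zInit_pos hM hs hε₀ hb).ne'
  have hε0 := precision_nonneg hM hs hb
  obtain ⟨hm, hmΛ, hlow, hB⟩ := spectral_bounds hn hA hM
  have hsym := precondOp_isSymmetric (M := M) hA
  have hκ := one_le_precondNumber hn hA hM
  have hκdef : precondNumber A M =
    (precondOp A M).singularValues 0 / (precondOp A M).singularValues (n - 1) := rfl
  rw [hκdef] at ht hprec hκ
  set m := (precondOp A M).singularValues (n - 1)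
  set Λ := (precondOp A M).singularValues 0
  obtain ⟨j, rfl⟩ : ∃ j, k = j + 1 := ⟨k - 1, by omega⟩
  have hPL := perturbedLanczos (A := A) hM hs hε₀ hb hβ
  have hbig {l : ℕ} (hl : l ≤ t + 1) (h : ¬ n = 1) :
      160000 * (Λ / m) ^ 2 * (l : ℝ) ^ 4 * ε₀ ≤ 1 := by
    have hl' : (l : ℝ) ≤ t + 1 := by exact_mod_cast hl
    refine le_trans ?_ (hprec.resolve_left h)
    gcongr
  have hunit : IsUnit (tridiag A b SolveM (j + 1)) := by
    by_cases h1 : n = 1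
    · subst h1
      have hj : j = 0 := by
        by_contra hj
        exact hβ 1 le_rfl (by omega) (beta_one_eq_zero hM hs hε₀ hb)
      subst hj
      refine isUnit_tridiag (alpha_zero_pos (b := b) (SolveM := SolveM) hA
        (qLow_dotProduct_qUp hz (Or.inl rfl))) fun x => ?_
      simp [tridiagForm]
    · exact isUnit_tridiag (by positivity : 0 < 9 / 10 * m) fun x =>
        hPL.le_tridiagForm hsym hm hmΛ hlow hB hε0 (hbig (by omega) h1) (Nat.lt_succ_self j) x
  refine ⟨hunit, matNorm_output_sub_le hA hM hz hε.le (j + 1) fun s hBs => ?_⟩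
  have hx : coeff A b SolveM (j + 1) (j + 1) = 0 := extend_of_le _ le_rfl
  have hsol : ∀ i ≤ j, _ := fun i hi => coeff_recurrence hunit (Nat.lt_succ_of_le hi)
  refine hPL.inner_error_le_of_residual hm hmΛ hlow hB hε.le hx hsol ?_ hBs
  by_cases h0 : (stateAt A b SolveM (j + 1)).beta = 0
  · simp only [h0, abs_zero, mul_zero, zero_mul]
    positivity
  · have hn1 : ¬ n = 1 := by
      rintro rfl
      rcases Nat.eq_zero_or_pos j with rfl | hj
      · exact h0 (beta_one_eq_zero hM hs hε₀ hb)
      · exact hβ 1 le_rfl (by omega) (beta_one_eq_zero hM hs hε₀ hb)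
    have hjt := hfin.resolve_right h0
    -- One index beyond the iterations used: bounding the residual needs `β (j + 1)` and the norm of
    -- `q (j + 1)`, available because this `β` is nonzero. Hence `t + 1` in the precision bound.
    have hPL' := perturbedLanczos (A := A) hM hs hε₀ hb (k := j + 2) fun i h1 h2 => by
      rcases Nat.lt_succ_iff_lt_or_eq.mp h2 with h | rfl
      · exact hβ i h1 h
      · exact h0
    refine hPL'.residual_le hsym hm hmΛ hlow hB hε0 ?_ hε hε1 hx hsol (by rw [hjt]; exact ht)
    exact_mod_cast hbig (l := j + 2) (by omega) hn1

end Main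

end PrecondLanczos

theorem theorem6p1 :
    ∃ c : ℝ, 0 < c ∧ ∃ C : ℝ, 0 < C ∧
      ∀ (n : ℕ) (A M : Matrix (Fin n) (Fin n) ℝ), A.PosDef → M.PosDef →
      ∀ (b : Fin n → ℝ) (SolveM : (Fin n → ℝ) → (Fin n → ℝ)) (ε ε₀ : ℝ),
        0 < ε → ε < 1 →
        ε₀ ≤ (ε / (PrecondLanczos.precondNumber A M * n)) ^ c →
        (∀ r : Fin n → ℝ,
          PrecondLanczos.matNorm M (SolveM r - M⁻¹ *ᵥ r) ≤
            ε₀ * PrecondLanczos.matNorm M (M⁻¹ *ᵥ r)) →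
        ∀ t : ℕ,
          t = ⌈C * (√(PrecondLanczos.precondNumber A M) *
            Real.log (PrecondLanczos.precondNumber A M / ε))⌉₊ →
          (b ≠ 0 → 0 < PrecondLanczos.zInit b SolveM ∧
            IsUnit (PrecondLanczos.finalT A b SolveM t)) ∧
          PrecondLanczos.matNorm A (PrecondLanczos.output A b SolveM t - A⁻¹ *ᵥ b) ≤
            ε * PrecondLanczos.matNorm A (A⁻¹ *ᵥ b) := by
  refine ⟨100, by norm_num, 24, by norm_num, ?_⟩
  intro n A M hA hM b SolveM ε ε₀ hε hε1 hε₀ hs t ht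
  by_cases hb : b = 0
  · subst hb
    refine ⟨fun h => absurd rfl h, ?_⟩
    rw [PrecondLanczos.output_zero, Matrix.mulVec_zero, sub_zero, PrecondLanczos.matNorm_zero,
      mul_zero]
  have hn : 0 < n := by
    rcases Nat.eq_zero_or_pos n with rfl | h
    · exact absurd (Subsingleton.elim _ _) hb
    · exact h
  have hn1 : (1 : ℝ) ≤ n := by exact_mod_cast hn
  have hκ := PrecondLanczos.one_le_precondNumber hn hA hM
  set κ := PrecondLanczos.precondNumber A M with hκdef
  have hκn : 1 ≤ κ * n := one_le_mul_of_one_le_of_one_le hκ hn1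
  have hlt : ε₀ < 1 := by
    refine hε₀.trans_lt (Real.rpow_lt_one (by positivity) ?_ (by norm_num))
    rw [div_lt_one (by linarith)]
    linarith
  have hlog : 0 < Real.log (κ / ε) :=
    Real.log_pos ((one_lt_div hε).mpr (by linarith))
  have ht1 : 1 ≤ t := by
    rw [ht, Nat.one_le_ceil_iff]
    have : 0 < √κ := Real.sqrt_pos.mpr (by linarith)
    positivity
  have hle : PrecondLanczos.numIter A b SolveM t ≤ t := Nat.sInf_le (Or.inl rfl)
  have hmem := PrecondLanczos.numIter_mem (A := A) (b := b) (SolveM := SolveM) t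
  have hprec : n = 1 ∨ 160000 * κ ^ 2 * ((t : ℝ) + 1) ^ 4 * ε₀ ≤ 1 := by
    by_cases h1 : n = 1
    · exact Or.inl h1
    · exact Or.inr (precision_bound hκ hε hε1 (by omega)
        (PrecondLanczos.precision_nonneg hM hs hb) hε₀ ht)
  obtain ⟨h1, h2⟩ := PrecondLanczos.solve_of_breakdown_or_long hn hA hM hb hs hlt hε hε1
    (by omega : 1 ≤ PrecondLanczos.numIter A b SolveM t) hle
    (fun i hi hlt => PrecondLanczos.beta_ne_zero_of_lt_numIter hi hlt)
    (hmem.imp_right fun h => h.2.2) (by rw [ht]; exact Nat.le_ceil _) hprec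
  exact ⟨fun _ => ⟨PrecondLanczos.zInit_pos hM hs hlt hb, h1⟩, h2⟩
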